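/- **Setting.** Let $X$ be an irreducible continuous-time Markov chain on a finite state space $\mathcal X$ with matrix of transition rates $Q$ and invariant probability measure $\pi$, and let $X^{\leftarrow}$ be its time reversal, with rates $Q^*(x,y)=\frac{\pi(y)}{\pi(x)}Q(y,x)$. Let $G\subset\mathcal X$ be nonempty, $A=\mathcal X\setminus G$, and $\pi_A=\pi(\cdot\cap A)/\pi(A)$. For $K\subset\mathcal X$ write $\tau_K^{\nu}=\inf\{t\ge 0: X_t\in K\}$ for the hitting time of $K$ when $X_0$ has law $\nu$ (with $\nu=\delta_x$ written $x$), and $\tau_K^{\leftarrow x}$ for the same time for $X^{\leftarrow}$. The quasistationary measure on $A$ is $\mu_A^*(\cdot)=\lim_{t\to\infty}\mathbf P(X_t^{\pi_A}=\cdot\mid\tau_G^{\pi_A}>t)$. For $\alpha,f,d,r\in(0,1)$ and $R>1$ put $$B_\alpha=\Big\{x\in A:\ \tfrac12\big[\mathbf P(\tau_G^x\le 2R)+\mathbf P(\tau_G^{\leftarrow x}\le 2R)\big]\le f^\alpha\Big\}.$$ Condition $Hp.G(R,d,f,r)$ says that (E) $\mathbf P(\tau_G^{\pi_A}\le 2R)\le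 f$; (T) $d_{TV}\big(\mathbf P(X_R^x\in\cdot),\mathbf P(X_R^{x'}\in\cdot)\big)\le d$ for all $x,x'\in B_\alpha$; and (Rc) $\sup_{x\in\mathcal X}\mathbf P(\tau^x_{B_\alpha\cup G}>R)<r$. If $r+2f^\alpha<\frac14$, let $$\bar c=\tfrac12-\sqrt{\tfrac14-(r+2f^\alpha)},\qquad \varepsilon_2=4\,[\bar c+2f+f^\alpha+d]+f^{1-\alpha}.$$ **Corollary 3.8.** (i) There are universal constants $C,\eta>0$ such that, whenever $Hp.G(R,d,f,r)$ holds with $r+2f^\alpha<\frac14$ and $r+\varepsilon_2\le\eta$, then with $\varepsilon=C(r+\varepsilon_2)$, for every probability measure $\mu$ with $\mathrm{Supp}(\mu)\subset B_\alpha$ and every $t\ge 0$, $$\left|\mathbf P\left[\frac{\tau_G^{\mu}}{\mathbf E[\tau_G^{\mu_A^*}]}\ge t\right]-e^{-t}\right|\le\varepsilon\,e^{-t}.$$ (ii) Fix $\alpha\in(0,1)$ and consider a sequence of such systems, indexed by $n$, satisfying $Hp.G(R_n,d_n,f_n,r_n)$ with $d_n,f_n,r_n\to0$. For all probability measures $\mu^{(n)}$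 with $\mathrm{Supp}(\mu^{(n)})\subset B_\alpha^{(n)}$, $$\mathbf E[\tau_G^{\mu_A^*}]\sim\mathbf E[\tau_G^{\mu^{(n)}}]\qquad(n\to\infty),$$ that is, the ratio of the two means tends to $1$. -/

import Mathlib

open Filter Topology MeasureTheory
open scoped NNReal ENNReal

noncomputable section

namespace Metastable

universe u v w

/-- `Q` is a matrix of transition rates on `S`. -/
structure IsRateMatrix {S : Type u} [Fintype S] (Q : Matrix S S ℝ) : Prop where
  nonneg : ∀ x y, x ≠ y → 0 ≤ Q x y
  row_sum : ∀ x, ∑ y, Q x y = 0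

/-- Every state can be reached from every state through jumps of positive rate. -/
def IsIrreducible {S : Type u} (Q : Matrix S S ℝ) : Prop :=
  ∀ x y, Relation.ReflTransGen (fun a b => a ≠ b ∧ 0 < Q a b) x y

/-- `π` is an invariant probability measure of the chain with rates `Q`. -/
def IsInvariant {S : Type u} [Fintype S] (Q : Matrix S S ℝ) (π : S → ℝ) : Prop :=
  π ∈ stdSimplex ℝ S ∧ ∀ y, ∑ x, π x * Q x y = 0

/-- The rates of the time reversal, `Q*(x, y) = π(y) Q(y, x) / π(x)`. -/
def timeReversal {S : Type u} (π : S → ℝ) (Q : Matrix S S ℝ) : Matrix S S ℝ :=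
  Matrix.of fun x y => π y / π x * Q y x

/-- A continuous time Markov chain with rates `Q`: right-continuous paths (for the discrete
topology of `S`), a law `ℙ x` for every starting point `x`, and the Markov property with
transition function `exp (t Q)`. -/
structure MarkovChain {S : Type u} [Fintype S] [DecidableEq S] (Q : Matrix S S ℝ) where
  Ω : Type v
  [measurableSpace : MeasurableSpace Ω]
  ℙ : S → Measure Ω
  isProbabilityMeasure : ∀ x, IsProbabilityMeasure (ℙ x)
  path : ℝ≥0 → Ω → S
  measurableSet_path : ∀ t y, MeasurableSet {ω | path t ω = y}
  right_continuous : ∀ t ω, ∀ᶠ s in 𝓝[>] t, path s ω = path t ω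
  start : ∀ x, (ℙ x).real {ω | path 0 ω = x} = 1
  markov : ∀ (x : S) (n : ℕ) (s : Fin (n + 1) → ℝ≥0) (a : Fin (n + 1) → S), Monotone s →
    ∀ (t : ℝ≥0) (y : S),
      (ℙ x).real {ω | (∀ i, path (s i) ω = a i) ∧ path (s (Fin.last n) + t) ω = y} =
        (ℙ x).real {ω | ∀ i, path (s i) ω = a i} *
          NormedSpace.exp ((t : ℝ) • Q) (a (Fin.last n)) y

attribute [instance] MarkovChain.measurableSpace MarkovChain.isProbabilityMeasure

namespace MarkovChain

variable {S : Type u} [Fintype S] [DecidableEq S] {Q : Matrix S S ℝ}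

/-- The law of the chain with initial distribution `ν`. -/
def law (X : MarkovChain.{u, v} Q) (ν : S → ℝ) : Measure X.Ω :=
  ∑ x, ENNReal.ofReal (ν x) • X.ℙ x

/-- The first hitting time `inf {t ≥ 0 : X_t ∈ K}`, infinite if `K` is never hit. -/
def hit (X : MarkovChain.{u, v} Q) (K : Set S) (ω : X.Ω) : ℝ≥0∞ :=
  ⨅ (t : ℝ≥0) (_ : X.path t ω ∈ K), (t : ℝ≥0∞)

/-- The mean hitting time of `K` for the initial distribution `ν`. -/
def meanHit (X : MarkovChain.{u, v} Q) (K : Set S) (ν : S → ℝ) : ℝ≥0∞ :=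
  ∫⁻ ω, X.hit K ω ∂(X.law ν)

/-- Total variation distance between the laws at time `t` of the chains started at `x`, `x'`. -/
def tvDist (X : MarkovChain.{u, v} Q) (t : ℝ≥0) (x x' : S) : ℝ :=
  1 / 2 * ∑ y, |(X.ℙ x).real {ω | X.path t ω = y} - (X.ℙ x').real {ω | X.path t ω = y}|

/-- The law at time `t` of the chain with initial distribution `ν`, conditioned on not having
hit `G` up to time `t`. -/
def condLaw (X : MarkovChain.{u, v} Q) (G : Set S) (ν : S → ℝ) (t : ℝ≥0) (y : S) : ℝ :=
  (X.law ν).real {ω | X.path t ω = y ∧ (t : ℝ≥0∞) < X.hit G ω} /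
    (X.law ν).real {ω | (t : ℝ≥0∞) < X.hit G ω}

end MarkovChain

/-- An irreducible chain on a finite state space with its invariant measure, its time reversal
and a nonempty target set `G`. -/
structure System where
  S : Type u
  [fintype : Fintype S]
  [decidableEq : DecidableEq S]
  Q : Matrix S S ℝ
  isRateMatrix : IsRateMatrix Q
  irreducible : IsIrreducible Q
  π : S → ℝ
  invariant : IsInvariant Q π
  X : MarkovChain.{u, v} Q
  Xrev : MarkovChain.{u, w} (timeReversal π Q)
  G : Set S
  nonempty_G : G.Nonempty

attribute [instance] System.fintype System.decidableEq

namespace System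

variable (𝒮 : System.{u, v, w})

/-- The trap, that is, the complement of the target set. -/
def A : Set 𝒮.S := 𝒮.Gᶜ

open Classical in
/-- The invariant measure restricted to `A` and normalized. -/
def piA (x : 𝒮.S) : ℝ :=
  (if x ∈ 𝒮.A then 𝒮.π x else 0) / ∑ y, if y ∈ 𝒮.A then 𝒮.π y else 0

/-- The basin `B_α` of the points of `A` from which neither the chain nor its time reversal is
likely to hit `G` before time `2R`. -/
def B (α : ℝ) (R : ℝ≥0) (f : ℝ) : Set 𝒮.S :=
  {x | x ∈ 𝒮.A ∧
    1 / 2 * ((𝒮.X.ℙ x).real {ω | 𝒮.X.hit 𝒮.G ω ≤ ((2 * R : ℝ≥0) : ℝ≥0∞)} +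
      (𝒮.Xrev.ℙ x).real {ω | 𝒮.Xrev.hit 𝒮.G ω ≤ ((2 * R : ℝ≥0) : ℝ≥0∞)}) ≤ f ^ α}

/-- Slow escape: started from `piA`, the chain hits `G` before `2R` with probability at most
`f`. -/
def SlowEscape (R : ℝ≥0) (f : ℝ) : Prop :=
  (𝒮.X.law 𝒮.piA).real {ω | 𝒮.X.hit 𝒮.G ω ≤ ((2 * R : ℝ≥0) : ℝ≥0∞)} ≤ f

/-- Fast thermalization in `B_α`. -/
def FastThermalization (α : ℝ) (R : ℝ≥0) (f d : ℝ) : Prop :=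
  ∀ x ∈ 𝒮.B α R f, ∀ x' ∈ 𝒮.B α R f, 𝒮.X.tvDist R x x' ≤ d

/-- Fast recurrence to `B_α ∪ G`. -/
def FastRecurrence (α : ℝ) (R : ℝ≥0) (f r : ℝ) : Prop :=
  ∀ x, (𝒮.X.ℙ x).real {ω | (R : ℝ≥0∞) < 𝒮.X.hit (𝒮.B α R f ∪ 𝒮.G) ω} < r

/-- The condition `Hp.G(R, d, f, r)`, with the exponent `α` of the basin. -/
structure HpG (α : ℝ) (R : ℝ≥0) (d f r : ℝ) : Prop where
  α_mem : α ∈ Set.Ioo (0 : ℝ) 1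
  one_lt_R : 1 < R
  d_mem : d ∈ Set.Ioo (0 : ℝ) 1
  f_mem : f ∈ Set.Ioo (0 : ℝ) 1
  r_mem : r ∈ Set.Ioo (0 : ℝ) 1
  slowEscape : 𝒮.SlowEscape R f
  fastThermalization : 𝒮.FastThermalization α R f d
  fastRecurrence : 𝒮.FastRecurrence α R f r

/-- The quasistationary measure on `A`, the limit as `t → ∞` of the law at time `t` of the chain
started from `piA` and conditioned on not having hit `G`. -/
def quasiStationary (y : 𝒮.S) : ℝ :=
  limUnder atTop fun t : ℝ≥0 => 𝒮.X.condLaw 𝒮.G 𝒮.piA t y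

/-- The mean hitting time `T*` of `G` from the quasistationary measure. -/
def Tstar : ℝ≥0∞ := 𝒮.X.meanHit 𝒮.G 𝒮.quasiStationary

/-- `μ` is a probability measure whose support is contained in `K`. -/
def IsProbOn (K : Set 𝒮.S) (μ : 𝒮.S → ℝ) : Prop :=
  μ ∈ stdSimplex ℝ 𝒮.S ∧ Function.support μ ⊆ K

end System

/-- `c̄ = 1/2 - √(1/4 - c)` with `c = r + 2 f^α`; used only for `c < 1/4`. -/
def cbar (α f r : ℝ) : ℝ := 1 / 2 - √(1 / 4 - (r + 2 * f ^ α))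

/-- `ε₂ = 4 (c̄ + 2 f + f^α + d) + f^(1 - α)`. -/
def eps2 (α d f r : ℝ) : ℝ :=
  4 * (cbar α f r + 2 * f + f ^ α + d) + f ^ (1 - α)

end Metastable

end

/-! Let `P_t` be the semigroup of the chain killed on `G`, and `T = 2R`. The hypotheses force `P_T`
to be nearly of rank one: uniformly in `x`, its row at `x` is close in ℓ¹ to `P_x(τ_G > T) π_A`. All
else follows from this and the likely survival from `π_A`.

Near rank one (`System.nearRankOne`): since chain and reversal escape equally fast from `π_A`,
Markov's inequality gives `π_A` mass at most `f^(1-α)` off the basin. Thermalization then brings the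
law at time `R` from a basin point close to the average of these laws over `π_A`, and slow escape
makes that average close to `π_A`. From other points, decompose at the first visit to `B_α ∪ G`: it
occurs before `R` except with probability `r`, and leaves a time in `[R, 2R]` to relax
(`abs_killed_mulVec_le`).

Consequences (`NearRankOne`, error `θ`): over a time `T` the mass surviving from `π_A` loses at most
a fraction `3θ`. The law conditioned on survival contracts by `1/2` per step `T`, so the
quasistationary limit exists. Survival from any point is at most twice that from `π_A`, so the error
of replacing `P_T` by its rank one approximation is proportional to the current survival
probability. This gives a relative error `12θ` uniform in time
(`NearRankOne.abs_alive_sub_limit_le`).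

The quasistationary law is a left eigenvector of the killed rates, with eigenvalue `-l < 0` by
irreducibility, so its hitting time is exactly exponential with mean `1/l` (`System.exists_rate`).
Rescaling time gives the first claim; integrating the tail bounds and squeezing gives the second. -/

noncomputable section

namespace Metastable

/-! ### The killed semigroup as a limit of grid observations. -/

section Killed

open scoped Matrix.Norms.Operator

variable {S : Type*} [Fintype S] [DecidableEq S]

/-- The projection onto the functions vanishing on `K`. -/
def survival (K : Set S) : Matrix S S ℝ := Matrix.diagonal (Kᶜ.indicator 1)

/-- The rates of the chain killed when it enters `K`. -/
def killedRate (K : Set S) (Q : Matrix S S ℝ) : Matrix S S ℝ := survival K * Q * survival K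

/-- The sub-Markov semigroup of the chain killed when it enters `K`. -/
def killed (K : Set S) (Q : Matrix S S ℝ) (t : ℝ) : Matrix S S ℝ :=
  survival K * NormedSpace.exp (t • killedRate K Q)

lemma survival_mul_self (K : Set S) : survival K * survival K = survival K := by
  classical
  simp only [survival, Matrix.diagonal_mul_diagonal]
  congr 1
  ext x
  by_cases h : x ∈ K <;> simp [h]

lemma survival_mul_killedRate (K : Set S) (Q : Matrix S S ℝ) :
    survival K * killedRate K Q = killedRate K Q := by
  simp only [killedRate, ← mul_assoc, survival_mul_self]

lemma killedRate_mul_survival (K : Set S) (Q : Matrix S S ℝ) :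
    killedRate K Q * survival K = killedRate K Q := by
  simp only [killedRate, mul_assoc, survival_mul_self]

lemma survival_commute_exp (K : Set S) (Q : Matrix S S ℝ) (t : ℝ) :
    Commute (survival K) (NormedSpace.exp (t • killedRate K Q)) := by
  refine Commute.exp_right (Commute.smul_right ?_ t)
  rw [Commute, SemiconjBy, survival_mul_killedRate, killedRate_mul_survival]

lemma survival_mul_killed (K : Set S) (Q : Matrix S S ℝ) (t : ℝ) :
    survival K * killed K Q t = killed K Q t := by
  rw [killed, ← mul_assoc, survival_mul_self]

lemma killed_mul_survival (K : Set S) (Q : Matrix S S ℝ) (t : ℝ) :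
    killed K Q t * survival K = killed K Q t := by
  rw [killed, mul_assoc, ← (survival_commute_exp K Q t).eq, ← mul_assoc, survival_mul_self]

lemma killed_zero (K : Set S) (Q : Matrix S S ℝ) : killed K Q 0 = survival K := by
  simp [killed]

lemma killed_add (K : Set S) (Q : Matrix S S ℝ) (s t : ℝ) :
    killed K Q (s + t) = killed K Q s * killed K Q t := by
  have h : Commute (s • killedRate K Q) (t • killedRate K Q) :=
    ((Commute.refl (killedRate K Q)).smul_left s).smul_right t
  nth_rw 2 [← killed_mul_survival]
  rw [mul_assoc, survival_mul_killed, killed, add_smul, Matrix.exp_add_of_commute _ _ h,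
    ← mul_assoc, ← killed]
  nth_rw 3 [killed]
  rw [← mul_assoc, killed_mul_survival]

lemma killed_apply_of_mem_left {K : Set S} {x : S} (hx : x ∈ K) (Q : Matrix S S ℝ) (t : ℝ) (y : S) :
    killed K Q t x y = 0 := by
  rw [← survival_mul_killed, survival, Matrix.diagonal_mul]
  simp [hx]

lemma killed_apply_of_mem_right {K : Set S} {y : S} (hy : y ∈ K) (Q : Matrix S S ℝ) (t : ℝ)
    (x : S) : killed K Q t x y = 0 := by
  rw [← killed_mul_survival, survival, Matrix.mul_diagonal]
  simp [hy]

lemma killedRate_apply (K : Set S) (Q : Matrix S S ℝ) (x y : S) :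
    killedRate K Q x y = Kᶜ.indicator 1 x * Q x y * Kᶜ.indicator 1 y := by
  rw [killedRate, survival, Matrix.mul_diagonal, Matrix.diagonal_mul]

lemma hasDerivAt_killed (K : Set S) (Q : Matrix S S ℝ) (t : ℝ) :
    HasDerivAt (killed K Q) (killed K Q t * killedRate K Q) t := by
  rw [killed, mul_assoc]
  exact (hasDerivAt_exp_smul_const (𝕂 := ℝ) (killedRate K Q) t).const_mul (survival K)

lemma killedRate_commute_killed (K : Set S) (Q : Matrix S S ℝ) (t : ℝ) :
    killedRate K Q * killed K Q t = killed K Q t * killedRate K Q := by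
  have h : Commute (killedRate K Q) (NormedSpace.exp (t • killedRate K Q)) :=
    ((Commute.refl (killedRate K Q)).smul_right t).exp_right
  rw [killed, ← mul_assoc, killedRate_mul_survival, mul_assoc, ← h.eq, ← mul_assoc,
    survival_mul_killedRate]

lemma killed_nat_mul (K : Set S) (Q : Matrix S S ℝ) (h : ℝ) (n : ℕ) :
    killed K Q h ^ (n + 1) = killed K Q ((n + 1 : ℕ) * h) := by
  induction n with
  | zero => simp
  | succ n ih => rw [pow_succ, ih, ← killed_add]; congr 1; push_cast; ring

lemma norm_pow_sub_pow_le {𝔸 : Type*} [NormedRing 𝔸] [NormOneClass 𝔸] (X Y : 𝔸) {a : ℝ} (ha : 1 ≤ a)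
    (hX : ‖X‖ ≤ a) (hY : ‖Y‖ ≤ a) (n : ℕ) : ‖X ^ n - Y ^ n‖ ≤ n * a ^ n * ‖X - Y‖ := by
  have ha0 : (0 : ℝ) ≤ a := by linarith
  induction n with
  | zero => simp
  | succ n ih =>
    have e : X ^ (n + 1) - Y ^ (n + 1) = X ^ n * (X - Y) + (X ^ n - Y ^ n) * Y := by
      rw [pow_succ, pow_succ]; noncomm_ring
    have h1 : ‖X ^ n‖ ≤ a ^ n := (norm_pow_le X n).trans (pow_le_pow_left₀ (norm_nonneg _) hX n)
    have h2 : a ^ n ≤ a ^ (n + 1) := pow_le_pow_right₀ ha (Nat.le_succ n)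
    calc ‖X ^ (n + 1) - Y ^ (n + 1)‖ ≤ ‖X ^ n‖ * ‖X - Y‖ + ‖X ^ n - Y ^ n‖ * ‖Y‖ := by
          rw [e]
          exact (norm_add_le _ _).trans (add_le_add (norm_mul_le _ _) (norm_mul_le _ _))
      _ ≤ a ^ (n + 1) * ‖X - Y‖ + (n * a ^ n * ‖X - Y‖) * a := by
          gcongr
          exact h1.trans h2
      _ = (n + 1 : ℕ) * a ^ (n + 1) * ‖X - Y‖ := by push_cast; ring

lemma norm_survival_le (K : Set S) : ‖survival K‖ ≤ 1 := by
  classical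
  rw [survival, Matrix.linfty_opNorm_diagonal]
  refine (pi_norm_le_iff_of_nonneg zero_le_one).2 fun x => ?_
  by_cases h : x ∈ K <;> simp [h]

lemma norm_survival_mul_le (K : Set S) (X : Matrix S S ℝ) : ‖survival K * X‖ ≤ ‖X‖ :=
  (norm_mul_le _ _).trans (mul_le_of_le_one_left (norm_nonneg _) (norm_survival_le K))

lemma norm_mul_survival_le (K : Set S) (X : Matrix S S ℝ) : ‖X * survival K‖ ≤ ‖X‖ :=
  (norm_mul_le _ _).trans (mul_le_of_le_one_right (norm_nonneg _) (norm_survival_le K))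

lemma norm_exp_smul_le [Nonempty S] (X : Matrix S S ℝ) {h a : ℝ} (hh : 0 ≤ h) (hX : ‖X‖ ≤ a) :
    ‖NormedSpace.exp (h • X)‖ ≤ Real.exp (h * a) := by
  have hle : ‖h • X‖ ≤ h * a := by
    rw [norm_smul, Real.norm_of_nonneg hh]
    gcongr
  have h1 := NormedSpace.exp_series_hasSum_exp' (𝕂 := ℝ) (h • X)
  have h2 := NormedSpace.exp_series_hasSum_exp' (𝕂 := ℝ) (h * a)
  rw [← Real.exp_eq_exp_ℝ] at h2
  refine (congrArg norm h1.tsum_eq).symm.trans_le ?_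
  refine tsum_of_norm_bounded h2 fun n => ?_
  rw [norm_smul, Real.norm_of_nonneg (by positivity), smul_eq_mul]
  gcongr
  exact (norm_pow_le _ n).trans (pow_le_pow_left₀ (norm_nonneg _) hle n)

/-- With `P = survival K`, both one-step matrices expand as `P + h P Q P + o(h)`. This is the
consistency needed for the product formula `tendsto_grid_killed`. -/
lemma hasDerivAt_survival_exp_sub_killed (K : Set S) (Q : Matrix S S ℝ) :
    HasDerivAt (fun h : ℝ => survival K * NormedSpace.exp (h • Q) * survival K - killed K Q h)
      0 0 := by
  have h1 := ((hasDerivAt_exp_smul_const (𝕂 := ℝ) Q 0).const_mul (survival K)).mul_const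
    (survival K)
  have h2 := h1.sub (hasDerivAt_killed K Q 0)
  rw [killed_zero, survival_mul_killedRate, zero_smul, NormedSpace.exp_zero, one_mul, killedRate,
    sub_self] at h2
  exact h2

/-- Checking for visits to `K` on a finer and finer grid gives the killed semigroup. -/
lemma tendsto_grid_killed (K : Set S) (Q : Matrix S S ℝ) {t : ℝ} (ht : 0 ≤ t) :
    Tendsto (fun n : ℕ => (survival K * NormedSpace.exp ((t / n) • Q) * survival K) ^ n) atTop
      (𝓝 (killed K Q t)) := by
  cases isEmpty_or_nonempty S
  -- The identity matrix has norm `1` only if `S` is nonempty, so the empty case is separate.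
  · exact tendsto_const_nhds.congr fun n => Subsingleton.elim _ _
  set φ : ℝ → Matrix S S ℝ :=
    fun h => survival K * NormedSpace.exp (h • Q) * survival K - killed K Q h with hφ
  have hφ0 : φ 0 = 0 := by simp [hφ, killed_zero, survival_mul_self]
  have hlim : Tendsto (fun n : ℕ => t / (n : ℝ)) atTop (𝓝 0) := tendsto_const_div_atTop_nhds_zero_nat t
  have ho : (fun h => φ h) =o[𝓝 0] fun h : ℝ => h := by
    have := (hasDerivAt_survival_exp_sub_killed K Q).isLittleO
    change (fun h => φ h - φ 0 - (h - 0) • (0 : Matrix S S ℝ)) =o[𝓝 0] fun h : ℝ => h - 0 at this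
    simpa only [hφ0, sub_zero, smul_zero] using this
  have ho' := ho.comp_tendsto hlim
  -- Telescoping the `n`-th powers costs `n` one-step errors, each `o(t / n)`; the powers themselves
  -- stay below `exp (t ‖Q‖)`.
  have hn : Tendsto (fun n : ℕ => (n : ℝ) * ‖φ (t / n)‖) atTop (𝓝 0) := by
    have hO : (fun n : ℕ => (n : ℝ) * ‖φ (t / n)‖) =o[atTop] fun n : ℕ => (n : ℝ) * (t / n) :=
      (Asymptotics.isBigO_refl _ _).mul_isLittleO ho'.norm_left
    refine (Asymptotics.isLittleO_one_iff ℝ).1 (hO.trans_isBigO ?_)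
    refine Asymptotics.IsBigO.of_bound t (Eventually.of_forall fun n => ?_)
    rcases Nat.eq_zero_or_pos n with rfl | h
    · simpa using ht
    · rw [mul_div_cancel₀ _ (by positivity)]
      simp [abs_of_nonneg ht]
  refine tendsto_iff_norm_sub_tendsto_zero.2 ?_
  refine squeeze_zero' (g := fun n : ℕ => Real.exp (t * ‖Q‖) * ((n : ℝ) * ‖φ (t / n)‖))
    (Eventually.of_forall fun n => norm_nonneg _) ?_ (by simpa using hn.const_mul (Real.exp (t * ‖Q‖)))
  filter_upwards [eventually_ge_atTop 1] with n hn1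
  obtain ⟨k, rfl⟩ := Nat.exists_eq_add_of_le' hn1
  have hpos : (0 : ℝ) < ((k + 1 : ℕ) : ℝ) := by positivity
  have hh : 0 ≤ t / ((k + 1 : ℕ) : ℝ) := by positivity
  have hM : ‖killedRate K Q‖ ≤ ‖Q‖ :=
    (norm_mul_survival_le K _).trans (norm_survival_mul_le K _)
  have e1 : killed K Q t = killed K Q (t / ((k + 1 : ℕ) : ℝ)) ^ (k + 1) := by
    rw [killed_nat_mul]
    congr 1
    field_simp
  rw [e1]
  refine (norm_pow_sub_pow_le _ _ (a := Real.exp (t / ((k + 1 : ℕ) : ℝ) * ‖Q‖))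
    (Real.one_le_exp (by positivity)) ?_ ?_ (k + 1)).trans (le_of_eq ?_)
  · exact (norm_mul_survival_le K _).trans
      ((norm_survival_mul_le K _).trans (norm_exp_smul_le Q hh le_rfl))
  · exact (norm_survival_mul_le K _).trans (norm_exp_smul_le _ hh hM)
  · rw [← Real.exp_nat_mul, ← mul_assoc ((k + 1 : ℕ) : ℝ), mul_div_cancel₀ _ hpos.ne']
    ring

end Killed

end Metastable

namespace Metastable

/-! ### From paths to the killed semigroup. -/

namespace MarkovChain

universe u v

variable {S : Type u} [Fintype S] [DecidableEq S] {Q : Matrix S S ℝ} (X : MarkovChain.{u, v} Q)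

lemma ae_start (x : S) : ∀ᵐ ω ∂(X.ℙ x), X.path 0 ω = x := by
  refine (mem_ae_iff_prob_eq_one (X.measurableSet_path 0 x)).2 ?_
  rw [← ENNReal.ofReal_one, ← X.start x, ofReal_measureReal]

lemma real_path (x : S) (t : ℝ≥0) (y : S) :
    (X.ℙ x).real {ω | X.path t ω = y} = NormedSpace.exp ((t : ℝ) • Q) x y := by
  have h := X.markov x 0 (fun _ => 0) (fun _ => x) monotone_const t y
  simp only [forall_const, zero_add] at h
  rw [X.start x, one_mul] at h
  rw [← h]
  refine measureReal_congr ?_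
  filter_upwards [X.ae_start x] with ω hω
  exact propext ⟨fun h => ⟨hω, h⟩, fun h => h.2⟩

/-- Right-continuity makes the inequality strict: a path outside `K` at time `t` stays outside for a
positive time after `t`, so the infimum exceeds `t`. -/
lemma lt_hit_iff (K : Set S) (t : ℝ≥0) (ω : X.Ω) :
    (t : ℝ≥0∞) < X.hit K ω ↔ ∀ s ≤ t, X.path s ω ∉ K := by
  constructor
  · intro h s hs hsK
    refine absurd h (not_lt.2 ?_)
    exact (iInf₂_le s hsK).trans (by exact_mod_cast hs)
  · intro h
    have hrc := X.right_continuous t ω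
    rw [eventually_nhdsWithin_iff, Metric.eventually_nhds_iff] at hrc
    obtain ⟨δ, hδ, hs⟩ := hrc
    have hlt : (t : ℝ≥0∞) < ((t + δ.toNNReal : ℝ≥0) : ℝ≥0∞) := by
      exact_mod_cast lt_add_of_pos_right t (Real.toNNReal_pos.2 hδ)
    refine hlt.trans_le (le_iInf₂ fun s hsK => ?_)
    by_contra hcon
    have hcon' : s < t + δ.toNNReal := by exact_mod_cast not_le.1 hcon
    rcases le_or_gt s t with hst | hst
    · exact h s hst hsK
    · refine h t le_rfl ?_
      rw [← hs (y := s) ?_ hst]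
      · exact hsK
      · have h1 : (s : ℝ) < t + δ := by
          have := NNReal.coe_lt_coe.2 hcon'
          rwa [NNReal.coe_add, Real.coe_toNNReal _ hδ.le] at this
        have h2 : (t : ℝ) < s := by exact_mod_cast hst
        rw [NNReal.dist_eq, abs_of_pos (by linarith)]
        linarith

/-- The Markov property is assumed for single past trajectories; summing over pasts with a common
present state gives it for events such as avoiding `K` on a grid. -/
lemma markov_finset (x : S) (n : ℕ) (s : Fin (n + 1) → ℝ≥0) (hs : Monotone s)
    (F : Finset (Fin (n + 1) → S)) (z : S) (hF : ∀ a ∈ F, a (Fin.last n) = z) (t : ℝ≥0) (y : S) :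
    (X.ℙ x).real {ω | (fun i => X.path (s i) ω) ∈ F ∧ X.path (s (Fin.last n) + t) ω = y} =
      (X.ℙ x).real {ω | (fun i => X.path (s i) ω) ∈ F} * NormedSpace.exp ((t : ℝ) • Q) z y := by
  have hm : ∀ a : Fin (n + 1) → S, MeasurableSet {ω | ∀ i, X.path (s i) ω = a i} := fun a => by
    rw [Set.ofPred_forall]
    exact MeasurableSet.iInter fun i => X.measurableSet_path _ _
  have e1 : {ω | (fun i => X.path (s i) ω) ∈ F} = ⋃ a ∈ F, {ω | ∀ i, X.path (s i) ω = a i} := by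
    ext ω
    simp [← funext_iff]
  have e2 : {ω | (fun i => X.path (s i) ω) ∈ F ∧ X.path (s (Fin.last n) + t) ω = y} =
      ⋃ a ∈ F, {ω | (∀ i, X.path (s i) ω = a i) ∧ X.path (s (Fin.last n) + t) ω = y} := by
    ext ω
    simp [← funext_iff]
  have hd : ∀ a b : Fin (n + 1) → S, a ≠ b →
      Disjoint {ω | ∀ i, X.path (s i) ω = a i} {ω | ∀ i, X.path (s i) ω = b i} := fun a b hab =>
    Set.disjoint_left.2 fun ω h1 h2 => hab (funext fun i => (h1 i).symm.trans (h2 i))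
  rw [e1, e2, measureReal_biUnion_finset (fun a _ b _ hab => hd a b hab) (fun a _ => hm a),
    Finset.sum_mul]
  refine (measureReal_biUnion_finset
    (fun a _ b _ hab => (hd a b hab).mono (fun _ h => h.1) (fun _ h => h.1))
    (fun a _ => (hm a).inter (X.measurableSet_path _ _))).trans ?_
  refine Finset.sum_congr rfl fun a ha => ?_
  rw [← hF a ha]
  exact X.markov x n s a hs t y

lemma measurableSet_grid (K : Set S) (h : ℝ≥0) (n : ℕ) (t : ℝ≥0) (y : S) :
    MeasurableSet {ω | (∀ j ≤ n, X.path (j * h) ω ∉ K) ∧ X.path t ω = y} := by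
  have hK : ∀ t, MeasurableSet {ω | X.path t ω ∉ K} := fun t => by
    have : {ω | X.path t ω ∉ K} = ⋃ z : (Kᶜ : Set S), {ω | X.path t ω = z} := by
      ext ω
      simp
    rw [this]
    exact MeasurableSet.iUnion fun z => X.measurableSet_path _ _
  have hj : {ω | ∀ j ≤ n, X.path (j * h) ω ∉ K} =
      ⋂ j, ⋂ (_ : j ≤ n), {ω | X.path (j * h) ω ∉ K} := by
    ext ω
    simp
  refine MeasurableSet.inter (s₁ := {ω | ∀ j ≤ n, X.path (j * h) ω ∉ K}) ?_
    (X.measurableSet_path t y)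
  rw [hj]
  exact MeasurableSet.iInter fun j => MeasurableSet.iInter fun _ => hK _

lemma real_grid (K : Set S) (x : S) (h : ℝ≥0) (n : ℕ) (y : S) :
    (X.ℙ x).real {ω | (∀ j ≤ n, X.path (j * h) ω ∉ K) ∧ X.path (n * h) ω = y} =
      (survival K * (NormedSpace.exp ((h : ℝ) • Q) * survival K) ^ n) x y := by
  classical
  induction n generalizing y with
  | zero =>
    simp only [Nat.le_zero, forall_eq, Nat.cast_zero, zero_mul, pow_zero, mul_one, survival]
    rw [Matrix.diagonal_apply]
    by_cases hx : x ∉ K ∧ x = y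
    · obtain ⟨hx, rfl⟩ := hx
      rw [if_pos rfl, Set.indicator_of_mem hx, Pi.one_apply, ← X.start x]
      refine congrArg _ (Set.ext fun ω => ⟨fun h => h.2, fun h => ⟨?_, h⟩⟩)
      rwa [show X.path 0 ω = x from h]
    · have : (X.ℙ x).real {ω | X.path 0 ω ∉ K ∧ X.path 0 ω = y} = 0 := by
        rw [measureReal_eq_zero_iff]
        refine measure_mono_null (t := {ω | X.path 0 ω ≠ x}) ?_ (ae_iff.1 (X.ae_start x))
        rintro ω ⟨h1, h2⟩ h3
        rw [h3] at h1 h2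
        exact hx ⟨h1, h2⟩
      rw [this]
      split_ifs with hxy
      · rw [Set.indicator_of_notMem]
        intro hxK
        exact hx ⟨hxK, hxy⟩
      · rfl
  | succ n ih =>
    rw [pow_succ, ← mul_assoc, ← mul_assoc]
    nth_rw 3 [survival]
    rw [Matrix.mul_diagonal, Matrix.mul_apply]
    by_cases hy : y ∈ K
    · rw [Set.indicator_of_notMem (by simpa using hy), mul_zero, measureReal_eq_zero_iff]
      convert measure_empty (μ := X.ℙ x)
      refine Set.eq_empty_iff_forall_notMem.2 ?_
      rintro ω ⟨h1, h2⟩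
      exact h1 (n + 1) le_rfl (h2 ▸ hy)
    · rw [Set.indicator_of_mem hy, Pi.one_apply, mul_one]
      have key : ∀ z, (X.ℙ x).real ({ω | (∀ j ≤ n, X.path (j * h) ω ∉ K) ∧ X.path (n * h) ω = z} ∩
          {ω | X.path (n * h + h) ω = y}) =
          (X.ℙ x).real {ω | (∀ j ≤ n, X.path (j * h) ω ∉ K) ∧ X.path (n * h) ω = z} *
            NormedSpace.exp ((h : ℝ) • Q) z y := fun z => by
        have hmono : Monotone fun i : Fin (n + 1) => (i : ℕ) * h := fun i j hij => by
          have : ((i : ℕ) : ℝ≥0) ≤ (j : ℕ) := by exact_mod_cast hij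
          exact mul_le_mul_left this h
        have e := X.markov_finset x n (fun i => (i : ℕ) * h) hmono
          (Finset.univ.filter fun a => (∀ i, a i ∉ K) ∧ a (Fin.last n) = z) z
          (fun a ha => ((Finset.mem_filter.1 ha).2).2) h y
        have e3 : ∀ ω, (∀ i : Fin (n + 1), X.path ((i : ℕ) * h) ω ∉ K) ↔
            ∀ j ≤ n, X.path (j * h) ω ∉ K := fun ω =>
          ⟨fun H j hj => H ⟨j, Nat.lt_succ_of_le hj⟩, fun H i => H i (Nat.lt_succ_iff.1 i.2)⟩
        simp only [Finset.mem_filter, Finset.mem_univ, true_and, e3, Fin.val_last] at e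
        exact e
      simp_rw [← ih, ← key]
      rw [← measureReal_biUnion_finset]
      · congr 1
        ext ω
        have e4 : (((n + 1 : ℕ) : ℝ≥0)) * h = n * h + h := by push_cast; ring
        simp only [Set.mem_ofPred_eq, Finset.mem_univ, Set.iUnion_true, Set.mem_iUnion,
          Set.mem_inter_iff, e4]
        constructor
        · rintro ⟨h1, h2⟩
          exact ⟨_, ⟨fun j hj => h1 j (hj.trans (Nat.le_succ n)), rfl⟩, h2⟩
        · rintro ⟨z, ⟨h1, -⟩, h2⟩
          refine ⟨fun j hj => ?_, h2⟩
          rcases Nat.le_succ_iff.1 hj with hj | rfl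
          · exact h1 j hj
          · rw [e4, h2]
            exact hy
      · intro z _ z' _ hzz
        exact Set.disjoint_left.2 fun ω h1 h2 => hzz (h1.1.2.symm.trans h2.1.2)
      · exact fun z _ => (X.measurableSet_grid K h n _ z).inter (X.measurableSet_path _ _)

/-- By right-continuity a visit to `K` at a time `s < t` lasts until some grid point of a fine
enough dyadic grid. Dyadic grids are nested, so the intersection is decreasing and its measure is a
limit. -/
lemma setOf_path_lt_hit (K : Set S) (t : ℝ≥0) (y : S) :
    {ω | X.path t ω = y ∧ (t : ℝ≥0∞) < X.hit K ω} = ⋂ m : ℕ,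
      {ω | (∀ j ≤ (2 ^ m : ℕ), X.path ((j : ℕ) * (t / (2 ^ m : ℕ))) ω ∉ K) ∧ X.path t ω = y} := by
  have hpos : ∀ m : ℕ, (0 : ℝ≥0) < (2 ^ m : ℕ) := fun m => by positivity
  ext ω
  simp only [Set.mem_ofPred_eq, Set.mem_iInter, lt_hit_iff]
  constructor
  · rintro ⟨h1, h2⟩ m
    refine ⟨fun j hj => h2 _ ?_, h1⟩
    have : (j : ℝ≥0) ≤ (2 ^ m : ℕ) := by exact_mod_cast hj
    calc (j : ℝ≥0) * (t / (2 ^ m : ℕ)) ≤ (2 ^ m : ℕ) * (t / (2 ^ m : ℕ)) := by gcongr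
      _ = t := mul_div_cancel₀ _ (hpos m).ne'
  · intro h
    refine ⟨(h 0).2, fun s hs => ?_⟩
    -- At `s = t` there is no room to the right, but `t` is itself a grid point.
    rcases hs.eq_or_lt with rfl | hs
    · have := (h 0).1 1 (by simp)
      simpa using this
    have hrc := X.right_continuous s ω
    rw [eventually_nhdsWithin_iff, Metric.eventually_nhds_iff] at hrc
    obtain ⟨δ, hδ, hsδ⟩ := hrc
    have ht0 : (0 : ℝ) < t := lt_of_le_of_lt s.2 (NNReal.coe_lt_coe.2 hs)
    have hη : 0 < min δ (t - s : ℝ) := lt_min hδ (sub_pos.2 (NNReal.coe_lt_coe.2 hs))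
    obtain ⟨m, hm⟩ := pow_unbounded_of_one_lt ((t : ℝ) / min δ (t - s : ℝ)) (one_lt_two)
    have hstep : (t : ℝ) / (2 ^ m : ℕ) < min δ (t - s : ℝ) := by
      rw [div_lt_iff₀ hη] at hm
      rw [div_lt_iff₀ (by positivity)]
      push_cast
      linarith [mul_comm (min δ (t - s : ℝ)) (2 ^ m)]
    set c : ℝ := (t : ℝ) / (2 ^ m : ℕ) with hc
    have hc0 : 0 < c := by positivity
    -- The first grid point strictly after `s`; the mesh `c` is small enough that it lies before `t`
    -- and within `δ` of `s`.
    set j : ℕ := ⌊(s : ℝ) / c⌋₊ + 1 with hj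
    have hj1 : (s : ℝ) < j * c := by
      have := Nat.lt_floor_add_one ((s : ℝ) / c)
      rw [div_lt_iff₀ hc0] at this
      rw [hj]
      exact_mod_cast this
    have hj2 : (j : ℝ) * c ≤ s + c := by
      have := Nat.floor_le (div_nonneg s.2 hc0.le : (0 : ℝ) ≤ (s : ℝ) / c)
      rw [le_div_iff₀ hc0] at this
      rw [hj]
      push_cast
      linarith
    have hj3 : j ≤ 2 ^ m := by
      have h4 : (j : ℝ) * c < (2 ^ m : ℕ) * c := by
        have h5 : ((2 ^ m : ℕ) : ℝ) * c = t := by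
          rw [hc]
          field_simp
        rw [h5]
        linarith [min_le_right δ (t - s : ℝ)]
      have := lt_of_mul_lt_mul_right h4 hc0.le
      exact_mod_cast this.le
    have hcoe : ((j * (t / (2 ^ m : ℕ)) : ℝ≥0) : ℝ) = j * c := by
      rw [hc]
      push_cast
      ring
    rw [← hsδ (y := j * (t / (2 ^ m : ℕ))) ?_ ?_]
    · exact (h m).1 j hj3
    · rw [NNReal.dist_eq, hcoe, abs_of_pos (by linarith)]
      linarith [min_le_left δ (t - s : ℝ)]
    · rw [Set.mem_Ioi, ← NNReal.coe_lt_coe, hcoe]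
      exact hj1

lemma measurableSet_path_lt_hit (K : Set S) (t : ℝ≥0) (y : S) :
    MeasurableSet {ω | X.path t ω = y ∧ (t : ℝ≥0∞) < X.hit K ω} := by
  rw [setOf_path_lt_hit]
  exact MeasurableSet.iInter fun m => X.measurableSet_grid K _ _ _ _

lemma survival_mul_pow (K : Set S) (E : Matrix S S ℝ) (n : ℕ) :
    survival K * (E * survival K) ^ n = (survival K * E * survival K) ^ n * survival K := by
  induction n with
  | zero => simp
  | succ n ih =>
    rw [pow_succ, ← mul_assoc, ih, pow_succ]
    simp only [mul_assoc, survival_mul_self]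

/-- The law of the chain killed on `K` is given by the killed semigroup. -/
lemma real_path_lt_hit (K : Set S) (x : S) (t : ℝ≥0) (y : S) :
    (X.ℙ x).real {ω | X.path t ω = y ∧ (t : ℝ≥0∞) < X.hit K ω} = killed K Q t x y := by
  have hpow : ∀ m : ℕ, ((2 ^ m : ℕ) : ℝ≥0) * (t / (2 ^ m : ℕ)) = t := fun m =>
    mul_div_cancel₀ _ (by positivity)
  have h1 : Tendsto (fun m : ℕ => (X.ℙ x).real
      {ω | (∀ j ≤ (2 ^ m : ℕ), X.path ((j : ℕ) * (t / (2 ^ m : ℕ))) ω ∉ K) ∧ X.path t ω = y}) atTop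
      (𝓝 ((X.ℙ x).real {ω | X.path t ω = y ∧ (t : ℝ≥0∞) < X.hit K ω})) := by
    rw [setOf_path_lt_hit]
    refine (ENNReal.tendsto_toReal (measure_ne_top _ _)).comp (tendsto_measure_iInter_atTop
      (fun m => (X.measurableSet_grid K _ _ _ _).nullMeasurableSet) ?_ ⟨0, measure_ne_top _ _⟩)
    refine antitone_nat_of_succ_le fun m ω => ?_
    rintro ⟨h1, h2⟩
    refine ⟨fun j hj => ?_, h2⟩
    -- Point `j` of one dyadic grid is point `2 * j` of the next.
    have := h1 (2 * j) (by rw [pow_succ]; omega)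
    have e : ((2 * j : ℕ) : ℝ≥0) * (t / (2 ^ (m + 1) : ℕ)) = j * (t / (2 ^ m : ℕ)) := by
      push_cast
      rw [pow_succ]
      field_simp
    rwa [e] at this
  have h2 : Tendsto (fun m : ℕ => ((survival K * NormedSpace.exp (((t : ℝ) / (2 ^ m : ℕ)) • Q) *
      survival K) ^ (2 ^ m) * survival K) x y) atTop (𝓝 (killed K Q t x y)) := by
    have h3 := (tendsto_grid_killed K Q t.2).comp (tendsto_pow_atTop_atTop_of_one_lt one_lt_two)
    have h4 := h3.mul_const (survival K)
    rw [show ((t : ℝ≥0).1 : ℝ) = (t : ℝ) from rfl, killed_mul_survival] at h4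
    exact (tendsto_pi_nhds.1 (tendsto_pi_nhds.1 h4 x)) y
  refine tendsto_nhds_unique h1 (h2.congr fun m => ?_)
  have := X.real_grid K x (t / (2 ^ m : ℕ)) (2 ^ m) y
  rw [hpow] at this
  rw [this, survival_mul_pow]
  push_cast
  rfl

lemma setOf_lt_hit (K : Set S) (t : ℝ≥0) : {ω | (t : ℝ≥0∞) < X.hit K ω} =
    ⋃ y ∈ (Finset.univ : Finset S), {ω | X.path t ω = y ∧ (t : ℝ≥0∞) < X.hit K ω} := by
  ext ω
  simp

lemma measurableSet_lt_hit (K : Set S) (t : ℝ≥0) : MeasurableSet {ω | (t : ℝ≥0∞) < X.hit K ω} := by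
  rw [setOf_lt_hit]
  exact Finset.measurableSet_biUnion _ fun y _ => X.measurableSet_path_lt_hit K t y

lemma real_lt_hit (K : Set S) (x : S) (t : ℝ≥0) :
    (X.ℙ x).real {ω | (t : ℝ≥0∞) < X.hit K ω} = ∑ y, killed K Q t x y := by
  rw [setOf_lt_hit, measureReal_biUnion_finset]
  · simp only [real_path_lt_hit]
  · intro z _ z' _ hzz
    exact Set.disjoint_left.2 fun ω h1 h2 => hzz (h1.1.symm.trans h2.1)
  · exact fun y _ => X.measurableSet_path_lt_hit K t y

lemma real_hit_le (K : Set S) (x : S) (t : ℝ≥0) :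
    (X.ℙ x).real {ω | X.hit K ω ≤ (t : ℝ≥0∞)} = 1 - ∑ y, killed K Q t x y := by
  rw [← real_lt_hit, ← probReal_compl_eq_one_sub (X.measurableSet_lt_hit K t)]
  congr 1
  ext ω
  simp

lemma killed_nonneg (X : MarkovChain.{u, v} Q) (K : Set S) (t : ℝ≥0) (x y : S) : 0 ≤ killed K Q t x y := by
  rw [← X.real_path_lt_hit]
  exact measureReal_nonneg

lemma sum_killed_le_one (X : MarkovChain.{u, v} Q) (K : Set S) (t : ℝ≥0) (x : S) : ∑ y, killed K Q t x y ≤ 1 := by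
  rw [← X.real_lt_hit]
  exact measureReal_le_one

lemma killed_le_exp (X : MarkovChain.{u, v} Q) (K : Set S) (t : ℝ≥0) (x y : S) :
    killed K Q t x y ≤ NormedSpace.exp ((t : ℝ) • Q) x y := by
  rw [← X.real_path_lt_hit, ← X.real_path]
  exact measureReal_mono fun ω h => h.1

lemma exp_nonneg (X : MarkovChain.{u, v} Q) (t : ℝ≥0) (x y : S) : 0 ≤ NormedSpace.exp ((t : ℝ) • Q) x y := by
  rw [← X.real_path]
  exact measureReal_nonneg

lemma sum_exp (X : MarkovChain.{u, v} Q) (t : ℝ≥0) (x : S) : ∑ y, NormedSpace.exp ((t : ℝ) • Q) x y = 1 := by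
  simp_rw [← X.real_path]
  rw [← measureReal_biUnion_finset]
  · rw [← probReal_univ (μ := X.ℙ x)]
    congr 1
    ext ω
    simp
  · intro z _ z' _ hzz
    exact Set.disjoint_left.2 fun ω h1 h2 => hzz (h1.symm.trans h2)
  · exact fun y _ => X.measurableSet_path t y

lemma law_real (ν : S → ℝ) (hν : ∀ x, 0 ≤ ν x) (s : Set X.Ω) :
    (X.law ν).real s = ∑ x, ν x * (X.ℙ x).real s := by
  rw [measureReal_def, law, Measure.finsetSum_apply, ENNReal.toReal_sum]
  · refine Finset.sum_congr rfl fun x _ => ?_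
    rw [Measure.smul_apply, smul_eq_mul, ENNReal.toReal_mul, ENNReal.toReal_ofReal (hν x),
      measureReal_def]
  · intro x _
    rw [Measure.smul_apply, smul_eq_mul]
    exact ENNReal.mul_ne_top ENNReal.ofReal_ne_top (measure_ne_top _ _)

instance (ν : S → ℝ) : IsFiniteMeasure (X.law ν) := by
  refine ⟨?_⟩
  rw [law, Measure.finsetSum_apply]
  refine ENNReal.sum_lt_top.2 fun x _ => ?_
  rw [Measure.smul_apply, smul_eq_mul]
  exact ENNReal.mul_lt_top ENNReal.ofReal_lt_top (measure_lt_top _ _)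

end MarkovChain

end Metastable

/-! ### Sub-Markov semigroups that are nearly of rank one. -/

namespace Metastable

/-- A sub-Markov semigroup which at time `T` is close to the rank one matrix
`(x, y) ↦ P_x(alive at T) p(y)`, for a probability `p` under which survival up to `T` is likely. -/
structure NearRankOne {S : Type*} [Fintype S] (P : ℝ≥0 → Matrix S S ℝ) (T : ℝ≥0) (p : S → ℝ)
    (θ : ℝ) : Prop where
  add : ∀ s t, P (s + t) = P s * P t
  nonneg : ∀ t x y, 0 ≤ P t x y
  sum_le_one : ∀ t x, ∑ y, P t x y ≤ 1
  T_pos : 0 < T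
  p_mem : p ∈ stdSimplex ℝ S
  θ_le : θ ≤ 1 / 12
  close : ∀ x, ∑ y, |P T x y - (∑ z, P T x z) * p y| ≤ θ
  survive : 1 - θ ≤ ∑ x, p x * ∑ y, P T x y

namespace NearRankOne

variable {S : Type*} [Fintype S] {P : ℝ≥0 → Matrix S S ℝ} {T : ℝ≥0} {p : S → ℝ} {θ : ℝ}

/-- The probability of survival up to time `t`. -/
def alive (P : ℝ≥0 → Matrix S S ℝ) (t : ℝ≥0) (x : S) : ℝ := ∑ y, P t x y

/-- The sub-probability law at time `t` for the initial distribution `p`. -/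
def flow (P : ℝ≥0 → Matrix S S ℝ) (p : S → ℝ) (t : ℝ≥0) (y : S) : ℝ := ∑ x, p x * P t x y

/-- The total mass of `flow`. -/
def mass (P : ℝ≥0 → Matrix S S ℝ) (p : S → ℝ) (t : ℝ≥0) : ℝ := ∑ x, p x * alive P t x

/-- The law at time `t` conditioned on survival. -/
def condFlow (P : ℝ≥0 → Matrix S S ℝ) (p : S → ℝ) (t : ℝ≥0) (y : S) : ℝ :=
  flow P p t y / mass P p t

lemma sum_flow (t : ℝ≥0) : ∑ y, flow P p t y = mass P p t := by
  simp only [flow, mass, alive, Finset.mul_sum]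
  rw [Finset.sum_comm]

variable (h : NearRankOne P T p θ)
include h

lemma θ_nonneg : 0 ≤ θ := by
  obtain ⟨x⟩ : Nonempty S := by
    by_contra hS
    have := not_nonempty_iff.1 hS
    have h1 := h.p_mem.2
    simp at h1
  exact (Finset.sum_nonneg fun y _ => abs_nonneg _).trans (h.close x)

lemma alive_nonneg (t : ℝ≥0) (x : S) : 0 ≤ alive P t x := Finset.sum_nonneg fun y _ => h.nonneg t x y

lemma alive_le_one (t : ℝ≥0) (x : S) : alive P t x ≤ 1 := h.sum_le_one t x

lemma flow_nonneg (t : ℝ≥0) (x : S) : 0 ≤ flow P p t x :=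
  Finset.sum_nonneg fun y _ => mul_nonneg (h.p_mem.1 y) (h.nonneg t y x)

lemma alive_add (s t : ℝ≥0) (x : S) : alive P (s + t) x = ∑ y, P s x y * alive P t y := by
  simp only [alive, h.add, Matrix.mul_apply, Finset.mul_sum]
  rw [Finset.sum_comm]

lemma flow_add (s t : ℝ≥0) (y : S) : flow P p (s + t) y = ∑ z, flow P p s z * P t z y := by
  simp only [flow, h.add, Matrix.mul_apply, Finset.mul_sum, Finset.sum_mul]
  rw [Finset.sum_comm]
  simp only [mul_assoc]

lemma mass_add (s t : ℝ≥0) : mass P p (s + t) = ∑ z, flow P p s z * alive P t z := by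
  rw [← sum_flow]
  simp only [h.flow_add, alive, Finset.mul_sum]
  rw [Finset.sum_comm]

lemma alive_antitone (x : S) : Antitone fun t => alive P t x := by
  intro s t hst
  obtain ⟨c, rfl⟩ := exists_add_of_le hst
  change alive P (s + c) x ≤ alive P s x
  rw [h.alive_add, alive]
  exact Finset.sum_le_sum fun y _ =>
    mul_le_of_le_one_right (h.nonneg s x y) (h.alive_le_one c y)

lemma mass_antitone : Antitone (mass P p) := fun _ _ hst =>
  Finset.sum_le_sum fun x _ => mul_le_mul_of_nonneg_left (h.alive_antitone x hst) (h.p_mem.1 x)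

lemma mass_le_one (t : ℝ≥0) : mass P p t ≤ 1 := by
  rw [← h.p_mem.2]
  exact Finset.sum_le_sum fun x _ => mul_le_of_le_one_right (h.p_mem.1 x) (h.alive_le_one t x)

lemma le_mass {t : ℝ≥0} (ht : t ≤ T) : 1 - θ ≤ mass P p t := h.survive.trans (h.mass_antitone ht)

lemma abs_apply_sub_le (x : S) (g : S → ℝ) {M : ℝ} (hg : ∀ y, |g y| ≤ M) :
    |∑ y, P T x y * g y - alive P T x * ∑ y, p y * g y| ≤ θ * M := by
  have e : ∑ y, P T x y * g y - alive P T x * ∑ y, p y * g y =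
      ∑ y, (P T x y - alive P T x * p y) * g y := by
    rw [Finset.mul_sum, ← Finset.sum_sub_distrib]
    exact Finset.sum_congr rfl fun y _ => by ring
  have hM : 0 ≤ M := (abs_nonneg _).trans (hg x)
  rw [e]
  calc |∑ y, (P T x y - alive P T x * p y) * g y|
      ≤ ∑ y, |P T x y - alive P T x * p y| * M := by
        refine (Finset.abs_sum_le_sum_abs _ _).trans (Finset.sum_le_sum fun y _ => ?_)
        rw [abs_mul]
        exact mul_le_mul_of_nonneg_left (hg y) (abs_nonneg _)
    _ ≤ θ * M := by
        rw [← Finset.sum_mul]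
        exact mul_le_mul_of_nonneg_right (h.close x) hM

/-- Near rank one applied to the function `alive P T` bounds `alive P (T + T)` below by `(1 - θ)
alive P T - θ`; integrating against the flow at time `t` gives a two-step recursion for the mass. -/
lemma mass_add_two_mul (t : ℝ≥0) :
    (1 - θ) * mass P p (t + T) - θ * mass P p t ≤ mass P p (t + T + T) := by
  have h0 := h.θ_nonneg
  have h1 : ∀ z, alive P T z * (1 - θ) - θ ≤ alive P (T + T) z := fun z => by
    have h2 := h.abs_apply_sub_le z (alive P T) (M := 1)
      fun y => by rw [abs_of_nonneg (h.alive_nonneg T y)]; exact h.alive_le_one T y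
    rw [← h.alive_add, abs_le] at h2
    have h3 : alive P T z * (1 - θ) ≤ alive P T z * mass P p T :=
      mul_le_mul_of_nonneg_left (h.le_mass le_rfl) (h.alive_nonneg T z)
    change _ ≤ alive P (T + T) z - alive P T z * mass P p T ∧ _ at h2
    linarith [h2.1]
  rw [add_assoc t, h.mass_add, h.mass_add, ← sum_flow, Finset.mul_sum, Finset.mul_sum,
    ← Finset.sum_sub_distrib]
  refine Finset.sum_le_sum fun z _ => ?_
  have := mul_le_mul_of_nonneg_left (h1 z) (h.flow_nonneg t z)
  linarith

-- Induction in continuous time: the base case is the whole interval `[0, T]`, the step is a shift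
-- by `T`.
omit h in
lemma induction_step (hT : 0 < T) {C : ℝ≥0 → Prop} (h0 : ∀ t ≤ T, C t) (h1 : ∀ t, C t → C (t + T))
    (t : ℝ≥0) : C t := by
  have key : ∀ n : ℕ, ∀ t ≤ n * T, C t := by
    intro n
    induction n with
    | zero => exact fun t ht => h0 t (ht.trans (by simp))
    | succ n ih =>
      intro t ht
      rcases le_total t T with h | h
      · exact h0 t h
      · have := h1 (t - T) (ih _ ?_)
        · rwa [tsub_add_cancel_of_le h] at this
        · rw [tsub_le_iff_right]
          calc t ≤ (n + 1 : ℕ) * T := ht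
            _ = n * T + T := by push_cast; ring
  obtain ⟨n, hn⟩ := exists_nat_ge (t / T)
  exact key n t ((div_le_iff₀ hT).1 hn)

/-- The ratio of masses over a step `T` satisfies `next ≥ 1 - θ - θ / current`. A ratio of at least
`1 - 3θ` is at least `1/2` because `θ ≤ 1/12`, so the lower bound `1 - 3θ` reproduces itself. -/
lemma mass_add_T (t : ℝ≥0) : (1 - 3 * θ) * mass P p t ≤ mass P p (t + T) := by
  have h0 := h.θ_nonneg
  have h12 := h.θ_le
  refine induction_step (C := fun t => (1 - 3 * θ) * mass P p t ≤ mass P p (t + T)) h.T_pos ?_ ?_ t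
  · intro t ht
    have h1 := h.mass_add_two_mul 0
    have h2 := h.mass_antitone (add_le_add_left ht T)
    have h3 := h.mass_le_one t
    have h4 := h.mass_le_one 0
    have h5 := h.le_mass le_rfl
    rw [zero_add] at h1
    nlinarith
  · intro t ht
    have h1 := h.mass_add_two_mul t
    have h2 : 0 ≤ mass P p (t + T) := Finset.sum_nonneg fun x _ =>
      mul_nonneg (h.p_mem.1 x) (h.alive_nonneg _ x)
    have h3 : mass P p t ≤ 2 * mass P p (t + T) := by nlinarith
    nlinarith

lemma mass_pos (t : ℝ≥0) : 0 < mass P p t := by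
  have h12 := h.θ_le
  refine induction_step (C := fun t => 0 < mass P p t) h.T_pos ?_ ?_ t
  · exact fun t ht => by linarith [h.le_mass ht]
  · intro t ht
    have := h.mass_add_T t
    nlinarith

lemma condFlow_nonneg (t : ℝ≥0) (x : S) : 0 ≤ condFlow P p t x :=
  div_nonneg (h.flow_nonneg t x) (h.mass_pos t).le

lemma sum_condFlow (t : ℝ≥0) : ∑ x, condFlow P p t x = 1 := by
  simp only [condFlow]
  rw [← Finset.sum_div, sum_flow, div_self (h.mass_pos t).ne']

lemma sum_condFlow_mul_alive (s t : ℝ≥0) :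
    ∑ x, condFlow P p t x * alive P s x = mass P p (t + s) / mass P p t := by
  rw [h.mass_add, Finset.sum_div]
  exact Finset.sum_congr rfl fun x _ => by rw [condFlow]; ring

/-- The rank one part of `P T` contributes exactly `p` after normalization, so only the `θ`-small
remainder depends on the past. -/
lemma condFlow_add_T (t : ℝ≥0) (y : S) : condFlow P p (t + T) y =
    p y + ∑ x, flow P p t x / mass P p (t + T) * (P T x y - alive P T x * p y) := by
  have hm := (h.mass_pos (t + T)).ne'
  have e : ∑ x, flow P p t x / mass P p (t + T) * (P T x y - alive P T x * p y) =
      (∑ x, flow P p t x * P T x y) / mass P p (t + T) -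
        (∑ x, flow P p t x * alive P T x) / mass P p (t + T) * p y := by
    rw [Finset.sum_div, Finset.sum_div, Finset.sum_mul, ← Finset.sum_sub_distrib]
    exact Finset.sum_congr rfl fun x _ => by ring
  rw [e, ← h.flow_add, ← h.mass_add, div_self hm, condFlow]
  ring

/-- By `condFlow_add_T` the difference is `θ` times that of the weights `ρ * condFlow`, with `ρ` the
inverse survival ratio over a step. As `ρ ≤ 2` and `ρ` varies by at most `4D`, the weights differ by
at most `6D`, and `6θ ≤ 1/2` is where `θ ≤ 1/12` comes from. -/
lemma contraction (t t' : ℝ≥0) :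
    ∑ y, |condFlow P p (t + T) y - condFlow P p (t' + T) y| ≤
      1 / 2 * ∑ y, |condFlow P p t y - condFlow P p t' y| := by
  have h0 := h.θ_nonneg
  have h12 := h.θ_le
  set D := ∑ y, |condFlow P p t y - condFlow P p t' y| with hD
  have hD0 : 0 ≤ D := Finset.sum_nonneg fun _ _ => abs_nonneg _
  set w : ℝ≥0 → S → ℝ := fun t x => flow P p t x / mass P p (t + T) with hw
  have h1 : ∑ y, |condFlow P p (t + T) y - condFlow P p (t' + T) y| ≤ θ * ∑ x, |w t x - w t' x| := by
    calc ∑ y, |condFlow P p (t + T) y - condFlow P p (t' + T) y|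
        = ∑ y, |∑ x, (w t x - w t' x) * (P T x y - alive P T x * p y)| := by
          refine Finset.sum_congr rfl fun y _ => ?_
          rw [h.condFlow_add_T, h.condFlow_add_T, add_sub_add_left_eq_sub, ← Finset.sum_sub_distrib]
          congr 1
          exact Finset.sum_congr rfl fun x _ => by rw [hw]; ring
      _ ≤ ∑ y, ∑ x, |w t x - w t' x| * |P T x y - alive P T x * p y| :=
          Finset.sum_le_sum fun y _ => (Finset.abs_sum_le_sum_abs _ _).trans_eq
            (Finset.sum_congr rfl fun x _ => abs_mul _ _)
      _ = ∑ x, |w t x - w t' x| * ∑ y, |P T x y - alive P T x * p y| := by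
          rw [Finset.sum_comm]
          simp only [Finset.mul_sum]
      _ ≤ θ * ∑ x, |w t x - w t' x| := by
          rw [Finset.mul_sum]
          refine Finset.sum_le_sum fun x _ => ?_
          rw [mul_comm]
          exact mul_le_mul_of_nonneg_right (h.close x) (abs_nonneg _)
  set ρ : ℝ≥0 → ℝ := fun t => mass P p t / mass P p (t + T) with hρ
  have hρ0 : ∀ t, 0 < ρ t := fun t => div_pos (h.mass_pos _) (h.mass_pos _)
  have hρ2 : ∀ t, ρ t ≤ 2 := fun t => by
    rw [hρ, div_le_iff₀ (h.mass_pos _)]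
    have := h.mass_add_T t
    have := h.mass_pos t
    nlinarith
  have hwρ : ∀ t x, w t x = ρ t * condFlow P p t x := fun t x => by
    have := (h.mass_pos t).ne'
    rw [hw, hρ, condFlow]
    field_simp
  -- `1 / ρ` is the mean of `alive P T`, a function with values in `[0, 1]`, under the conditioned
  -- law.
  have hinv : |(ρ t')⁻¹ - (ρ t)⁻¹| ≤ D := by
    have e : ∀ t, (ρ t)⁻¹ = ∑ x, condFlow P p t x * alive P T x := fun t => by
      rw [h.sum_condFlow_mul_alive, hρ, inv_div]
    rw [e, e, ← Finset.sum_sub_distrib, hD]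
    refine (Finset.abs_sum_le_sum_abs _ _).trans (Finset.sum_le_sum fun x _ => ?_)
    rw [← sub_mul, abs_mul, abs_sub_comm, abs_of_nonneg (h.alive_nonneg T x)]
    exact mul_le_of_le_one_right (abs_nonneg _) (h.alive_le_one T x)
  have hdiff : |ρ t - ρ t'| ≤ 4 * D := by
    have e : ρ t - ρ t' = ρ t * ρ t' * ((ρ t')⁻¹ - (ρ t)⁻¹) := by
      have := (hρ0 t).ne'
      have := (hρ0 t').ne'
      field_simp
    rw [e, abs_mul, abs_of_pos (mul_pos (hρ0 t) (hρ0 t'))]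
    have : ρ t * ρ t' ≤ 2 * 2 := mul_le_mul (hρ2 t) (hρ2 t') (hρ0 t').le zero_le_two
    calc ρ t * ρ t' * |(ρ t')⁻¹ - (ρ t)⁻¹| ≤ (2 * 2) * D := by gcongr
      _ = 4 * D := by ring
  have h2 : ∑ x, |w t x - w t' x| ≤ 6 * D := by
    calc ∑ x, |w t x - w t' x|
        ≤ ∑ x, (2 * |condFlow P p t x - condFlow P p t' x| + |ρ t - ρ t'| * condFlow P p t' x) := by
          refine Finset.sum_le_sum fun x _ => ?_
          have e : w t x - w t' x = ρ t * (condFlow P p t x - condFlow P p t' x) +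
              (ρ t - ρ t') * condFlow P p t' x := by rw [hwρ, hwρ]; ring
          rw [e]
          refine (abs_add_le _ _).trans ?_
          rw [abs_mul, abs_mul, abs_of_pos (hρ0 t), abs_of_nonneg (h.condFlow_nonneg t' x)]
          gcongr
          exact hρ2 t
      _ = 2 * D + |ρ t - ρ t'| := by
          rw [Finset.sum_add_distrib, ← Finset.mul_sum, ← Finset.mul_sum, h.sum_condFlow, mul_one]
      _ ≤ 6 * D := by linarith
  calc _ ≤ θ * ∑ x, |w t x - w t' x| := h1
    _ ≤ θ * (6 * D) := by gcongr
    _ ≤ 1 / 2 * D := by nlinarith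

lemma sum_abs_condFlow_sub_le (n : ℕ) (t t' : ℝ≥0) (ht : n * T ≤ t) (ht' : n * T ≤ t') :
    ∑ y, |condFlow P p t y - condFlow P p t' y| ≤ 2 * (1 / 2) ^ n := by
  induction n generalizing t t' with
  | zero =>
    calc ∑ y, |condFlow P p t y - condFlow P p t' y|
        ≤ ∑ y, (condFlow P p t y + condFlow P p t' y) := Finset.sum_le_sum fun y _ => by
          refine (abs_sub _ _).trans ?_
          rw [abs_of_nonneg (h.condFlow_nonneg t y), abs_of_nonneg (h.condFlow_nonneg t' y)]
      _ = 2 * (1 / 2) ^ 0 := by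
          rw [Finset.sum_add_distrib, h.sum_condFlow, h.sum_condFlow]
          norm_num
  | succ n ih =>
    have e : ((n + 1 : ℕ) : ℝ≥0) * T = n * T + T := by push_cast; ring
    rw [e] at ht ht'
    obtain ⟨c, rfl⟩ := exists_add_of_le ht
    obtain ⟨c', rfl⟩ := exists_add_of_le ht'
    rw [add_right_comm, add_right_comm _ T c']
    refine (h.contraction _ _).trans ?_
    have := ih (n * T + c) (n * T + c') le_self_add le_self_add
    rw [pow_succ]
    linarith

/-- The law conditioned on survival converges. -/
lemma exists_tendsto_condFlow :
    ∃ m : S → ℝ, ∀ y, Tendsto (fun t => condFlow P p t y) atTop (𝓝 (m y)) := by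
  have key : ∀ y, ∃ l, Tendsto (fun t => condFlow P p t y) atTop (𝓝 l) := fun y => by
    refine cauchySeq_tendsto_of_complete (Metric.cauchySeq_iff.2 fun ε hε => ?_)
    obtain ⟨n, hn⟩ := exists_pow_lt_of_lt_one (half_pos hε) (one_half_lt_one (α := ℝ))
    refine ⟨n * T, fun t ht t' ht' => ?_⟩
    have h1 := h.sum_abs_condFlow_sub_le n t t' ht ht'
    have h2 := Finset.single_le_sum (f := fun y => |condFlow P p t y - condFlow P p t' y|)
      (fun _ _ => abs_nonneg _) (Finset.mem_univ y)
    rw [Real.dist_eq]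
    linarith
  choose m hm using key
  exact ⟨m, hm⟩

section Limit

variable {m : S → ℝ} (hm : ∀ y, Tendsto (fun t => condFlow P p t y) atTop (𝓝 (m y)))
include hm

lemma limit_mem : m ∈ stdSimplex ℝ S := by
  refine ⟨fun x => ge_of_tendsto' (hm x) fun t => h.condFlow_nonneg t x, ?_⟩
  refine tendsto_nhds_unique (tendsto_finsetSum Finset.univ fun y _ => hm y) ?_
  simp only [h.sum_condFlow]
  exact tendsto_const_nhds

/-- Quasistationarity: passing to the limit in the semigroup identity, evolving for a time `s` only
rescales the limit law. -/
lemma limit_mul (s : ℝ≥0) (y : S) :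
    ∑ x, m x * P s x y = (∑ x, m x * alive P s x) * m y := by
  have h1 : Tendsto (fun t => ∑ x, condFlow P p t x * P s x y) atTop (𝓝 (∑ x, m x * P s x y)) :=
    tendsto_finsetSum _ fun x _ => (hm x).mul_const _
  have h2 : Tendsto (fun t => ∑ x, condFlow P p t x * alive P s x) atTop
      (𝓝 (∑ x, m x * alive P s x)) := tendsto_finsetSum _ fun x _ => (hm x).mul_const _
  have h3 : Tendsto (fun t => condFlow P p (t + s) y) atTop (𝓝 (m y)) :=
    (hm y).comp (tendsto_atTop_mono (fun t => le_self_add) tendsto_id)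
  refine tendsto_nhds_unique h1 ((h2.mul h3).congr fun t => ?_)
  rw [h.sum_condFlow_mul_alive]
  have e : ∑ x, condFlow P p t x * P s x y = flow P p (t + s) y / mass P p t := by
    rw [h.flow_add, Finset.sum_div]
    exact Finset.sum_congr rfl fun x _ => by rw [condFlow]; ring
  have := (h.mass_pos (t + s)).ne'
  rw [e, condFlow]
  field_simp

lemma le_limit_alive_T : 1 - 3 * θ ≤ ∑ x, m x * alive P T x := by
  have h2 : Tendsto (fun t => ∑ x, condFlow P p t x * alive P T x) atTop
      (𝓝 (∑ x, m x * alive P T x)) := tendsto_finsetSum _ fun x _ => (hm x).mul_const _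
  refine ge_of_tendsto' h2 fun t => ?_
  rw [h.sum_condFlow_mul_alive, le_div_iff₀ (h.mass_pos t)]
  exact h.mass_add_T t

end Limit

/-- This turns additive errors into relative ones. Over a step `T` the constant `2` survives because
`alive` becomes at most `(1 + 2θ) mass P p t`, while the mass keeps a factor `1 - 3θ`. -/
lemma alive_le_two_mul_mass (t : ℝ≥0) (x : S) : alive P t x ≤ 2 * mass P p t := by
  have h0 := h.θ_nonneg
  have h12 := h.θ_le
  refine induction_step (C := fun t => ∀ x, alive P t x ≤ 2 * mass P p t) h.T_pos ?_ ?_ t x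
  · exact fun t ht x => by linarith [h.le_mass ht, h.alive_le_one t x]
  · intro t ht x
    have h1 := h.abs_apply_sub_le x (alive P t) (M := 2 * mass P p t)
      fun y => by rw [abs_of_nonneg (h.alive_nonneg t y)]; exact ht y
    rw [← h.alive_add, abs_le, add_comm T t] at h1
    change _ ∧ alive P (t + T) x - alive P T x * mass P p t ≤ _ at h1
    have h2 := mul_le_mul_of_nonneg_right (h.alive_le_one T x) (h.mass_pos t).le
    have h3 := h.mass_add_T t
    have h4 := h.mass_pos t
    nlinarith [h1.2]

lemma abs_alive_sub_le (t : ℝ≥0) (x : S) :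
    |alive P (t + T) x - alive P T x * mass P p t| ≤ θ * (2 * mass P p t) := by
  have h1 := h.abs_apply_sub_le x (alive P t) (M := 2 * mass P p t)
    fun y => by rw [abs_of_nonneg (h.alive_nonneg t y)]; exact h.alive_le_two_mul_mass t y
  rwa [← h.alive_add, add_comm T t] at h1

/-- From a point where survival up to `T` is likely, the survival probability is close to the one
for the quasistationary law, with a relative error that is uniform in time. -/
lemma abs_alive_sub_limit_le {m : S → ℝ}
    (hm : ∀ y, Tendsto (fun t => condFlow P p t y) atTop (𝓝 (m y))) {x : S}
    (hx : 1 - θ ≤ alive P T x) (t : ℝ≥0) :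
    |alive P t x - ∑ y, m y * alive P t y| ≤ 12 * θ * ∑ y, m y * alive P t y := by
  have h0 := h.θ_nonneg
  have h12 := h.θ_le
  obtain ⟨hm0, hm1⟩ := h.limit_mem hm
  have hle : ∀ t, ∑ y, m y * alive P t y ≤ 1 := fun t => by
    rw [← hm1]
    exact Finset.sum_le_sum fun y _ => mul_le_of_le_one_right (hm0 y) (h.alive_le_one t y)
  have hT := h.le_limit_alive_T hm
  -- For `t ≤ T` both probabilities lie in `[1 - 3θ, 1]`. Later, both are compared with the mass at
  -- `t - T`.
  rcases le_total t T with ht | ht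
  · have h1 := h.alive_antitone x ht
    have h2 := h.alive_le_one t x
    have h3 : ∑ y, m y * alive P T y ≤ ∑ y, m y * alive P t y :=
      Finset.sum_le_sum fun y _ => mul_le_mul_of_nonneg_left (h.alive_antitone y ht) (hm0 y)
    have h4 := hle t
    rw [abs_le]
    constructor <;> nlinarith
  · obtain ⟨s, rfl⟩ := exists_add_of_le ht
    rw [add_comm T s]
    have hq := h.mass_pos s
    have h1 := abs_le.1 (h.abs_alive_sub_le s x)
    have h2 : |∑ y, m y * alive P (s + T) y - (∑ y, m y * alive P T y) * mass P p s| ≤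
        θ * (2 * mass P p s) := by
      have e : ∑ y, m y * alive P (s + T) y - (∑ y, m y * alive P T y) * mass P p s =
          ∑ y, m y * (alive P (s + T) y - alive P T y * mass P p s) := by
        rw [Finset.sum_mul, ← Finset.sum_sub_distrib]
        exact Finset.sum_congr rfl fun y _ => by ring
      rw [e]
      refine (Finset.abs_sum_le_sum_abs _ _).trans ?_
      calc ∑ y, |m y * (alive P (s + T) y - alive P T y * mass P p s)|
          ≤ ∑ y, m y * (θ * (2 * mass P p s)) := Finset.sum_le_sum fun y _ => by
            rw [abs_mul, abs_of_nonneg (hm0 y)]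
            exact mul_le_mul_of_nonneg_left (h.abs_alive_sub_le s y) (hm0 y)
        _ = θ * (2 * mass P p s) := by rw [← Finset.sum_mul, hm1, one_mul]
    have h2' := abs_le.1 h2
    have h3 := h.alive_le_one T x
    have h4 := hle T
    set q := mass P p s
    set e := ∑ y, m y * alive P (s + T) y
    have h5 : (1 - 3 * θ) * q ≤ (∑ y, m y * alive P T y) * q :=
      mul_le_mul_of_nonneg_right hT hq.le
    have h6 : (∑ y, m y * alive P T y) * q ≤ q := mul_le_of_le_one_left hq.le h4
    have h7 : (1 - θ) * q ≤ alive P T x * q := mul_le_mul_of_nonneg_right hx hq.le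
    have h8 : alive P T x * q ≤ q := mul_le_of_le_one_left hq.le h3
    -- The two survival probabilities differ by at most `7θ q`, and `e ≥ (1 - 5θ) q ≥ 7/12 q`; hence
    -- the constant `12`.
    have h9 : 7 * q ≤ 12 * e := by nlinarith
    have h10 := mul_le_mul_of_nonneg_left h9 h0
    rw [abs_le]
    constructor <;> linarith

end NearRankOne

end Metastable

namespace Metastable

/-! ### Eigenvectors and the first-visit decomposition. -/

section Calculus

open scoped Matrix.Norms.Operator

variable {S : Type*} [Fintype S]

lemma hasDerivAt_mulVec_apply {F : ℝ → Matrix S S ℝ} {F' : Matrix S S ℝ} {t : ℝ}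
    (hF : HasDerivAt F F' t) (ψ : S → ℝ) (x : S) :
    HasDerivAt (fun s => (F s).mulVec ψ x) (F'.mulVec ψ x) t := by
  let L : Matrix S S ℝ →ₗ[ℝ] ℝ :=
    { toFun := fun M => M.mulVec ψ x
      map_add' := fun M N => by simp [Matrix.add_mulVec]
      map_smul' := fun c M => by simp [Matrix.smul_mulVec] }
  exact (LinearMap.toContinuousLinearMap L).hasFDerivAt.comp_hasDerivAt t hF

lemma hasDerivAt_vecMul_apply {F : ℝ → Matrix S S ℝ} {F' : Matrix S S ℝ} {t : ℝ}
    (hF : HasDerivAt F F' t) (v : S → ℝ) (y : S) :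
    HasDerivAt (fun s => Matrix.vecMul v (F s) y) (Matrix.vecMul v F' y) t := by
  let L : Matrix S S ℝ →ₗ[ℝ] ℝ :=
    { toFun := fun M => Matrix.vecMul v M y
      map_add' := fun M N => by simp [Matrix.vecMul_add]
      map_smul' := fun c M => by simp [Matrix.vecMul_smul] }
  exact (LinearMap.toContinuousLinearMap L).hasFDerivAt.comp_hasDerivAt t hF

lemma vecMul_exp_of_eigenvector [DecidableEq S] {M : Matrix S S ℝ} {v : S → ℝ} {c : ℝ}
    (hv : Matrix.vecMul v M = c • v) (t : ℝ) :
    Matrix.vecMul v (NormedSpace.exp (t • M)) = Real.exp (c * t) • v := by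
  ext y
  have hd : ∀ t, HasDerivAt
      (fun t => Real.exp (-c * t) * Matrix.vecMul v (NormedSpace.exp (t • M)) y) 0 t := fun t => by
    have h1 : HasDerivAt (fun t => Real.exp (-c * t)) (Real.exp (-c * t) * -c) t := by
      simpa using ((hasDerivAt_id t).const_mul (-c)).exp
    have h2 := hasDerivAt_vecMul_apply (hasDerivAt_exp_smul_const' (𝕂 := ℝ) M t) v y
    refine (h1.mul h2).congr_deriv ?_
    rw [← Matrix.vecMul_vecMul, hv, Matrix.smul_vecMul, Pi.smul_apply, smul_eq_mul]
    ring
  have h := is_const_of_deriv_eq_zero (fun t => (hd t).differentiableAt) (fun t => (hd t).deriv) t 0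
  have e : Real.exp (c * t) * Real.exp (-c * t) = 1 := by
    rw [← Real.exp_add]
    simp
  simp only [mul_zero, Real.exp_zero, zero_smul, NormedSpace.exp_zero, Matrix.vecMul_one,
    one_mul] at h
  rw [Pi.smul_apply, smul_eq_mul, ← h, ← mul_assoc, e, one_mul]

universe u v

variable {S : Type u} [Fintype S] [DecidableEq S] {Q : Matrix S S ℝ}

/-- Decomposition of the chain killed on `K` at its first visit to `K' ⊇ K`. -/
lemma abs_killed_mulVec_le (X : MarkovChain.{u, v} Q) (hQ : IsRateMatrix Q) {K K' : Set S}
    (hK : K ⊆ K') (R : ℝ≥0) (ψ : S → ℝ) {a b : ℝ} (ha0 : 0 ≤ a)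
    (ha : ∀ z ∈ K', ∀ t : ℝ≥0, R ≤ t → t ≤ 2 * R → |(killed K Q t).mulVec ψ z| ≤ a)
    (hb : ∀ z, |(killed K Q R).mulVec ψ z| ≤ b) {x : S} (hx : x ∉ K') :
    |(killed K Q ((2 * R : ℝ≥0) : ℝ)).mulVec ψ x| ≤ a + b * ∑ y, killed K' Q R x y := by
  set T : ℝ := ((2 * R : ℝ≥0) : ℝ) with hTdef
  have hT : T = 2 * (R : ℝ) := by rw [hTdef]; push_cast; ring
  -- Duhamel interpolation: kill on `K'` up to time `s`, then on `K`. Its derivative is the flux of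
  -- first visits to `K'`, and `-L'` is the density of the first visit time.
  set g : ℝ → ℝ := fun s => (killed K' Q s * killed K Q (T - s)).mulVec ψ x with hg
  set L : ℝ → ℝ := fun s => (killed K' Q s).mulVec 1 x with hL
  set g' : ℝ → ℝ := fun s => (killed K' Q s).mulVec
    ((killedRate K' Q - killedRate K Q).mulVec ((killed K Q (T - s)).mulVec ψ)) x with hg'
  set L' : ℝ → ℝ := fun s => (killed K' Q s).mulVec ((killedRate K' Q).mulVec 1) x with hL'
  have hgd : ∀ s, HasDerivAt g (g' s) s := fun s => by
    have h1 := (hasDerivAt_killed K Q (T - s)).scomp s ((hasDerivAt_id s).const_sub T)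
    have h2 := hasDerivAt_mulVec_apply ((hasDerivAt_killed K' Q s).mul h1) ψ x
    refine h2.congr_deriv ?_
    simp only [hg', Matrix.mulVec_mulVec, Function.comp_apply]
    rw [← killedRate_commute_killed K Q (T - s)]
    rw [neg_smul, one_smul]
    congr 2
    noncomm_ring
  have hLd : ∀ s, HasDerivAt L (L' s) s := fun s => by
    have h2 := hasDerivAt_mulVec_apply (hasDerivAt_killed K' Q s) 1 x
    refine h2.congr_deriv ?_
    simp only [hL', Matrix.mulVec_mulVec]
  have hbound : ∀ s : ℝ, 0 ≤ s → s ≤ R → |g' s| ≤ -(a * L' s) := fun s hs0 hsR => by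
    lift s to ℝ≥0 using hs0
    set w := (killed K Q (T - s)).mulVec ψ with hw
    have hwa : ∀ z ∈ K', |w z| ≤ a := fun z hz => by
      have e : T - s = ((2 * R - s : ℝ≥0) : ℝ) := by
        rw [NNReal.coe_sub, ← hTdef]
        rw [← NNReal.coe_le_coe, ← hTdef]
        linarith [R.coe_nonneg]
      have := ha z hz (2 * R - s) ?_ tsub_le_self
      · rwa [← e] at this
      · rw [← NNReal.coe_le_coe, ← e, hT]
        linarith
    have hc : ∀ c ∉ K', |(killedRate K' Q - killedRate K Q).mulVec w c| ≤
        -(a * (killedRate K' Q).mulVec 1 c) := fun c hcK' => by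
      have hcK : c ∉ K := fun h => hcK' (hK h)
      -- The rows of `Q` sum to zero, so the killed row sum is minus the rate of jumps into `K'`.
      have e1 : (killedRate K' Q).mulVec 1 c = -∑ z, K'.indicator (Q c) z := by
        rw [eq_neg_iff_add_eq_zero, ← hQ.row_sum c, Matrix.mulVec, dotProduct,
          ← Finset.sum_add_distrib]
        refine Finset.sum_congr rfl fun z _ => ?_
        rw [killedRate_apply]
        by_cases hz : z ∈ K' <;> simp [hz, hcK']
      rw [e1, mul_neg, neg_neg, Finset.mul_sum]
      refine (Finset.abs_sum_le_sum_abs _ _).trans (Finset.sum_le_sum fun z _ => ?_)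
      change |(killedRate K' Q c z - killedRate K Q c z) * w z| ≤ _
      rw [killedRate_apply, killedRate_apply, abs_mul]
      by_cases hz' : z ∈ K'
      · have hne : c ≠ z := fun h => hcK' (h ▸ hz')
        have h0 := hQ.nonneg c z hne
        have h1 := hwa z hz'
        by_cases hz : z ∈ K
        · simp [hz, hz', mul_nonneg ha0 h0]
        · simp only [hcK', hcK, hz, hz', Set.indicator_of_mem, Set.indicator_of_notMem,
            Set.mem_compl_iff, not_false_eq_true, not_true_eq_false, Pi.one_apply, one_mul,
            mul_zero, mul_one, zero_sub, abs_neg, abs_of_nonneg h0]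
          rw [mul_comm a]
          gcongr
      · have hz : z ∉ K := fun h => hz' (hK h)
        simp [hcK', hcK, hz, hz']
    simp only [hg', hL']
    rw [Matrix.mulVec, dotProduct, Matrix.mulVec, dotProduct, Finset.mul_sum,
      ← Finset.sum_neg_distrib]
    refine (Finset.abs_sum_le_sum_abs _ _).trans (Finset.sum_le_sum fun c _ => ?_)
    rw [abs_mul, abs_of_nonneg (X.killed_nonneg K' s x c)]
    by_cases hcK' : c ∈ K'
    · rw [killed_apply_of_mem_right hcK']
      simp
    · have := mul_le_mul_of_nonneg_left (hc c hcK') (X.killed_nonneg K' s x c)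
      linarith
  -- This is `|g'| ≤ -a L'` in integrated form, with both signs of `ε`.
  have hanti : ∀ ε : ℝ, |ε| = 1 → AntitoneOn (fun s => ε * g s + a * L s) (Set.Icc 0 R) := by
    intro ε hε
    have hd : ∀ s, HasDerivAt (fun s => ε * g s + a * L s) (ε * g' s + a * L' s) s := fun s =>
      ((hgd s).const_mul ε).add ((hLd s).const_mul a)
    refine antitoneOn_of_deriv_nonpos (convex_Icc _ _)
      (fun s _ => (hd s).continuousAt.continuousWithinAt)
      (fun s _ => (hd s).differentiableAt.differentiableWithinAt) fun s hs => ?_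
    have hs' := interior_subset hs
    rw [(hd s).deriv]
    have h1 := hbound s hs'.1 hs'.2
    have h2 := le_abs_self (ε * g' s)
    rw [abs_mul, hε, one_mul] at h2
    linarith
  have hg0 : g 0 = (killed K Q T).mulVec ψ x := by
    simp only [hg, killed_zero, sub_zero]
    rw [← Matrix.mulVec_mulVec, survival, Matrix.mulVec_diagonal]
    simp [hx]
  have hLR : L R = ∑ y, killed K' Q R x y := by simp [hL, Matrix.mulVec, dotProduct]
  have hL0 : L 0 ≤ 1 := by
    have := X.sum_killed_le_one K' 0 x
    simpa [hL, Matrix.mulVec, dotProduct] using this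
  have hLR0 : 0 ≤ L R := hLR ▸ Finset.sum_nonneg fun y _ => X.killed_nonneg K' R x y
  have hgR : |g R| ≤ b * L R := by
    have e : T - R = R := by rw [hT]; ring
    simp only [hg, e]
    rw [← Matrix.mulVec_mulVec, hLR, Finset.mul_sum, Matrix.mulVec, dotProduct]
    refine (Finset.abs_sum_le_sum_abs _ _).trans (Finset.sum_le_sum fun c _ => ?_)
    rw [abs_mul, abs_of_nonneg (X.killed_nonneg K' R x c), mul_comm]
    exact mul_le_mul_of_nonneg_right (hb c) (X.killed_nonneg K' R x c)
  have h1 := hanti 1 (by simp) ⟨le_rfl, R.coe_nonneg⟩ ⟨R.coe_nonneg, le_rfl⟩ R.coe_nonneg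
  have h2 := hanti (-1) (by simp) ⟨le_rfl, R.coe_nonneg⟩ ⟨R.coe_nonneg, le_rfl⟩ R.coe_nonneg
  have h3 := abs_le.1 hgR
  have h4 : a * L 0 ≤ a := mul_le_of_le_one_right ha0 hL0
  have h5 : 0 ≤ a * L R := mul_nonneg ha0 hLR0
  simp only at h1 h2
  rw [← hg0, ← hLR, abs_le]
  constructor <;> linarith [h3.1, h3.2]

end Calculus

/-! ### Invariant measure and time reversal. -/

section Invariant

universe u
variable {S : Type u} [Fintype S] {Q : Matrix S S ℝ} {π : S → ℝ}

/-- Positivity propagates along jumps: a state of zero mass has no inflow, so no state of positive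
mass can jump to it. -/
lemma IsInvariant.pos (hQ : IsRateMatrix Q) (hirr : IsIrreducible Q) (hπ : IsInvariant Q π) (y : S) :
    0 < π y := by
  obtain ⟨x, hx⟩ : ∃ x, 0 < π x := by
    by_contra! hcon
    have h0 : ∑ x, π x ≤ 0 := Finset.sum_nonpos fun x _ => hcon x
    linarith [hπ.1.2]
  induction hirr x y with
  | refl => exact hx
  | @tail a b _ hab ih =>
    obtain ⟨hne, hpos⟩ := hab
    refine (hπ.1.1 b).lt_of_ne fun hb => ?_
    have hterm : ∀ z ∈ Finset.univ, 0 ≤ π z * Q z b := fun z _ => by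
      by_cases hz : z = b
      · rw [hz, ← hb, zero_mul]
      · exact mul_nonneg (hπ.1.1 z) (hQ.nonneg z b hz)
    have := (Finset.sum_eq_zero_iff_of_nonneg hterm).1 (hπ.2 b) a (Finset.mem_univ a)
    exact (mul_pos ih hpos).ne' this

lemma IsInvariant.sum_mul_exp [DecidableEq S] (hπ : IsInvariant Q π) (t : ℝ) (y : S) :
    ∑ x, π x * NormedSpace.exp (t • Q) x y = π y := by
  have h : Matrix.vecMul π Q = (0 : ℝ) • π := by
    ext y
    simpa [Matrix.vecMul, dotProduct] using hπ.2 y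
  simpa [Matrix.vecMul, dotProduct] using congrFun (vecMul_exp_of_eigenvector h t) y

/-- Reversal is transposition conjugated by `diagonal π`; both operations commute with the
exponential, and the diagonal projection is unaffected. -/
lemma killed_timeReversal [DecidableEq S] (hπ : ∀ x, 0 < π x) (K : Set S) (t : ℝ) (x y : S) :
    killed K (timeReversal π Q) t x y = π y / π x * killed K Q t y x := by
  let U : (Matrix S S ℝ)ˣ :=
    { val := Matrix.diagonal π
      inv := Matrix.diagonal π⁻¹
      val_inv := by
        rw [Matrix.diagonal_mul_diagonal, ← Matrix.diagonal_one]
        congr 1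
        ext x
        exact mul_inv_cancel₀ (hπ x).ne'
      inv_val := by
        rw [Matrix.diagonal_mul_diagonal, ← Matrix.diagonal_one]
        congr 1
        ext x
        exact inv_mul_cancel₀ (hπ x).ne' }
  have hU : (U : Matrix S S ℝ) = Matrix.diagonal π := rfl
  have hU' : ((U⁻¹ : (Matrix S S ℝ)ˣ) : Matrix S S ℝ) = Matrix.diagonal π⁻¹ := rfl
  have e1 : t • killedRate K (timeReversal π Q) =
      ((U⁻¹ : (Matrix S S ℝ)ˣ) : Matrix S S ℝ) * (t • killedRate K Q).transpose * U := by
    ext a b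
    rw [hU, hU', Matrix.mul_diagonal, Matrix.diagonal_mul, Matrix.smul_apply, Matrix.transpose_apply,
      Matrix.smul_apply, killedRate_apply, killedRate_apply, timeReversal, Matrix.of_apply,
      Pi.inv_apply, smul_eq_mul, smul_eq_mul]
    ring
  have e2 : killed K Q t y x = NormedSpace.exp (t • killedRate K Q) y x * Kᶜ.indicator 1 x := by
    rw [killed, (survival_commute_exp K Q t).eq, survival, Matrix.mul_diagonal]
  rw [e2, killed, e1, Matrix.exp_units_conj', Matrix.exp_transpose, hU, hU', survival,
    Matrix.diagonal_mul, Matrix.mul_diagonal, Matrix.diagonal_mul, Matrix.transpose_apply,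
    Pi.inv_apply]
  ring

end Invariant

end Metastable

namespace Metastable

/-! ### The killed chain of the system is nearly of rank one. -/

namespace System

universe u v w

variable (𝒮 : System.{u, v, w})

/-- The semigroup of the chain killed on the target. -/
def sg (t : ℝ≥0) : Matrix 𝒮.S 𝒮.S ℝ := killed 𝒮.G 𝒮.Q t

lemma sg_nonneg (t : ℝ≥0) (x y : 𝒮.S) : 0 ≤ 𝒮.sg t x y := 𝒮.X.killed_nonneg _ t x y

lemma sum_sg_le_one (t : ℝ≥0) (x : 𝒮.S) : ∑ y, 𝒮.sg t x y ≤ 1 := 𝒮.X.sum_killed_le_one _ t x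

lemma sg_add (s t : ℝ≥0) : 𝒮.sg (s + t) = 𝒮.sg s * 𝒮.sg t := by
  rw [sg, NNReal.coe_add, killed_add, sg, sg]

lemma sg_left {x : 𝒮.S} (hx : x ∈ 𝒮.G) (t : ℝ≥0) (y : 𝒮.S) : 𝒮.sg t x y = 0 :=
  killed_apply_of_mem_left hx _ _ _

lemma sg_right {y : 𝒮.S} (hy : y ∈ 𝒮.G) (t : ℝ≥0) (x : 𝒮.S) : 𝒮.sg t x y = 0 :=
  killed_apply_of_mem_right hy _ _ _

lemma sum_sg_antitone (x : 𝒮.S) : Antitone fun t => ∑ y, 𝒮.sg t x y := by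
  intro s t hst
  change ∑ y, 𝒮.sg t x y ≤ ∑ y, 𝒮.sg s x y
  simp only [sg]
  rw [← 𝒮.X.real_lt_hit, ← 𝒮.X.real_lt_hit]
  refine measureReal_mono fun ω h => ?_
  have : (s : ℝ≥0∞) ≤ t := by exact_mod_cast hst
  exact this.trans_lt h

lemma π_pos (x : 𝒮.S) : 0 < 𝒮.π x := 𝒮.invariant.pos 𝒮.isRateMatrix 𝒮.irreducible x

section PiA

variable (hA : 𝒮.A.Nonempty)
include hA

open Classical in
lemma piA_denom_pos : 0 < ∑ y, if y ∈ 𝒮.A then 𝒮.π y else 0 := by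
  obtain ⟨x, hx⟩ := hA
  refine Finset.sum_pos' (fun y _ => ?_) ⟨x, Finset.mem_univ x, ?_⟩
  · split_ifs
    exacts [(𝒮.π_pos y).le, le_rfl]
  · rw [if_pos hx]
    exact 𝒮.π_pos x

lemma piA_mem : 𝒮.piA ∈ stdSimplex ℝ 𝒮.S := by
  classical
  have h := 𝒮.piA_denom_pos hA
  refine ⟨fun x => div_nonneg ?_ h.le, ?_⟩
  · split_ifs
    exacts [(𝒮.π_pos x).le, le_rfl]
  · simp only [piA]
    rw [← Finset.sum_div]
    exact div_self h.ne'

end PiA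

lemma piA_of_mem {x : 𝒮.S} (hx : x ∈ 𝒮.G) : 𝒮.piA x = 0 := by
  have : x ∉ 𝒮.A := fun h => h hx
  simp [piA, this]

lemma exists_piA_eq (hA : 𝒮.A.Nonempty) :
    ∃ Z > 0, ∀ x ∉ 𝒮.G, 𝒮.piA x = 𝒮.π x / Z := by
  classical
  refine ⟨_, 𝒮.piA_denom_pos hA, fun x hx => ?_⟩
  have : x ∈ 𝒮.A := hx
  rw [piA, if_pos this]

/-- Killing only removes mass from the stationary flow of `π`, so `piA` is sub-invariant. -/
lemma sum_piA_mul_sg_le (hA : 𝒮.A.Nonempty) (t : ℝ≥0) (y : 𝒮.S) :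
    ∑ x, 𝒮.piA x * 𝒮.sg t x y ≤ 𝒮.piA y := by
  obtain ⟨Z, hZ, h⟩ := 𝒮.exists_piA_eq hA
  by_cases hy : y ∈ 𝒮.G
  · rw [Finset.sum_eq_zero fun x _ => by rw [𝒮.sg_right hy, mul_zero]]
    exact (𝒮.piA_mem hA).1 y
  · rw [h y hy, ← 𝒮.invariant.sum_mul_exp t y, Finset.sum_div]
    refine Finset.sum_le_sum fun x _ => ?_
    rw [mul_div_right_comm]
    by_cases hx : x ∈ 𝒮.G
    · rw [𝒮.sg_left hx, mul_zero]
      exact mul_nonneg (div_nonneg (𝒮.π_pos x).le hZ.le) (𝒮.X.exp_nonneg t x y)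
    · rw [h x hx]
      exact mul_le_mul_of_nonneg_left (𝒮.X.killed_le_exp _ t x y)
        (div_nonneg (𝒮.π_pos x).le hZ.le)

lemma sum_piA_mul_sg_le_exp (hA : 𝒮.A.Nonempty) (t : ℝ≥0) (y : 𝒮.S) :
    ∑ x, 𝒮.piA x * 𝒮.sg t x y ≤ ∑ x, 𝒮.piA x * NormedSpace.exp ((t : ℝ) • 𝒮.Q) x y :=
  Finset.sum_le_sum fun x _ =>
    mul_le_mul_of_nonneg_left (𝒮.X.killed_le_exp _ t x y) ((𝒮.piA_mem hA).1 x)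

/-- From `piA`, the chain and its time reversal survive with the same probability. -/
lemma sum_piA_mul_reversal (hA : 𝒮.A.Nonempty) (t : ℝ≥0) :
    ∑ x, 𝒮.piA x * ∑ y, killed 𝒮.G (timeReversal 𝒮.π 𝒮.Q) t x y =
      ∑ x, 𝒮.piA x * ∑ y, 𝒮.sg t x y := by
  obtain ⟨Z, hZ, h⟩ := 𝒮.exists_piA_eq hA
  simp only [Finset.mul_sum]
  rw [Finset.sum_comm]
  refine Finset.sum_congr rfl fun y _ => Finset.sum_congr rfl fun x _ => ?_
  rw [killed_timeReversal 𝒮.π_pos]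
  change 𝒮.piA x * (𝒮.π y / 𝒮.π x * 𝒮.sg t y x) = _
  by_cases hx : x ∈ 𝒮.G
  · simp [𝒮.sg_right hx]
  by_cases hy : y ∈ 𝒮.G
  · simp [𝒮.sg_left hy]
  rw [h x hx, h y hy]
  have := (𝒮.π_pos x).ne'
  field_simp

section Hyp

variable {𝒮} {α : ℝ} {R : ℝ≥0} {d f r : ℝ} (h : 𝒮.HpG α R d f r) (hB : (𝒮.B α R f).Nonempty)
include h hB

omit h in
lemma A_nonempty : 𝒮.A.Nonempty := hB.mono fun _ hx => hx.1

lemma le_sum_piA_mul_sum_sg {t : ℝ≥0} (ht : t ≤ 2 * R) :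
    1 - f ≤ ∑ x, 𝒮.piA x * ∑ y, 𝒮.sg t x y := by
  have hA := A_nonempty hB
  have h1 := h.slowEscape
  rw [SlowEscape, MarkovChain.law_real _ _ (𝒮.piA_mem hA).1] at h1
  simp only [MarkovChain.real_hit_le, mul_sub, mul_one, Finset.sum_sub_distrib,
    (𝒮.piA_mem hA).2] at h1
  have h2 : ∑ x, 𝒮.piA x * ∑ y, 𝒮.sg (2 * R) x y ≤ ∑ x, 𝒮.piA x * ∑ y, 𝒮.sg t x y :=
    Finset.sum_le_sum fun x _ =>
      mul_le_mul_of_nonneg_left (𝒮.sum_sg_antitone x ht) ((𝒮.piA_mem hA).1 x)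
  change 1 - ∑ x, 𝒮.piA x * ∑ y, 𝒮.sg (2 * R) x y ≤ f at h1
  linarith

omit h hB in
lemma le_sum_sg {z : 𝒮.S} (hz : z ∈ 𝒮.B α R f) {t : ℝ≥0} (ht : t ≤ 2 * R) :
    1 - 2 * f ^ α ≤ ∑ y, 𝒮.sg t z y := by
  have h1 := hz.2
  have h2 : (0 : ℝ) ≤ (𝒮.Xrev.ℙ z).real
    {ω | 𝒮.Xrev.hit 𝒮.G ω ≤ ((2 * R : ℝ≥0) : ℝ≥0∞)} := measureReal_nonneg
  rw [MarkovChain.real_hit_le] at h1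
  change 1 / 2 * (1 - ∑ y, 𝒮.sg (2 * R) z y + _) ≤ _ at h1
  have := 𝒮.sum_sg_antitone z ht
  simp only at this
  linarith

-- Markov's inequality: the averaged escape probability `e` has `piA`-mean at most `f`, because the
-- reversal contributes the same mean as the chain, and it exceeds `f ^ α` on `A` off the basin.
open Classical in
lemma sum_piA_compl_le :
    ∑ x, (if x ∈ 𝒮.B α R f then 0 else 𝒮.piA x) ≤ f ^ (1 - α) := by
  have hA := A_nonempty hB
  have hf := h.f_mem.1
  have hfα : 0 < f ^ α := Real.rpow_pos_of_pos hf α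
  have hp := (𝒮.piA_mem hA).1
  set e : 𝒮.S → ℝ := fun x => 1 / 2 * ((1 - ∑ y, 𝒮.sg (2 * R) x y) +
    (1 - ∑ y, killed 𝒮.G (timeReversal 𝒮.π 𝒮.Q) ((2 * R : ℝ≥0) : ℝ) x y)) with he
  have he0 : ∀ x, 0 ≤ e x := fun x => by
    have h1 := 𝒮.sum_sg_le_one (2 * R) x
    have h2 := 𝒮.Xrev.sum_killed_le_one 𝒮.G (2 * R) x
    simp only [he]
    linarith
  have hsum : ∑ x, 𝒮.piA x * e x ≤ f := by
    have h1 := 𝒮.sum_piA_mul_reversal hA (2 * R)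
    have h2 := le_sum_piA_mul_sum_sg h hB le_rfl
    have h3 : ∑ x, 𝒮.piA x * e x = 1 / 2 * ((∑ x, 𝒮.piA x - ∑ x, 𝒮.piA x * ∑ y, 𝒮.sg (2 * R) x y) +
        (∑ x, 𝒮.piA x - ∑ x, 𝒮.piA x *
          ∑ y, killed 𝒮.G (timeReversal 𝒮.π 𝒮.Q) ((2 * R : ℝ≥0) : ℝ) x y)) := by
      rw [← Finset.sum_sub_distrib, ← Finset.sum_sub_distrib, ← Finset.sum_add_distrib,
        Finset.mul_sum]
      exact Finset.sum_congr rfl fun x _ => by rw [he]; ring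
    rw [h3, (𝒮.piA_mem hA).2, h1]
    linarith
  have hterm : ∀ x, (if x ∈ 𝒮.B α R f then 0 else 𝒮.piA x) * f ^ α ≤ 𝒮.piA x * e x := fun x => by
    split_ifs with hx
    · rw [zero_mul]
      exact mul_nonneg (hp x) (he0 x)
    · by_cases hxG : x ∈ 𝒮.G
      · simp [𝒮.piA_of_mem hxG]
      · refine mul_le_mul_of_nonneg_left ?_ (hp x)
        by_contra hcon
        refine hx ⟨hxG, ?_⟩
        rw [MarkovChain.real_hit_le, MarkovChain.real_hit_le]
        exact (not_le.1 hcon).le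
  rw [Real.rpow_sub hf, Real.rpow_one, le_div_iff₀ hfα, Finset.sum_mul]
  exact (Finset.sum_le_sum fun x _ => hterm x).trans hsum

/-- The distance from the law at time `R` to `piA`, from a starting point in the basin. -/
lemma sum_abs_sg_R_sub_le {z : 𝒮.S} (hz : z ∈ 𝒮.B α R f) :
    ∑ y, |𝒮.sg R z y - 𝒮.piA y| ≤ 2 * f ^ α + 2 * d + 2 * f ^ (1 - α) + 2 * f := by
  classical
  have hA := A_nonempty hB
  have hp := 𝒮.piA_mem hA
  have hR2 : R ≤ 2 * R := le_mul_of_one_le_left R.2 one_le_two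
  set E : Matrix 𝒮.S 𝒮.S ℝ := NormedSpace.exp ((R : ℝ) • 𝒮.Q) with hE
  have hE1 : ∀ x, ∑ y, E x y = 1 := fun x => 𝒮.X.sum_exp R x
  have hE0 : ∀ x y, 0 ≤ E x y := fun x y => 𝒮.X.exp_nonneg R x y
  have hle : ∀ x y, 𝒮.sg R x y ≤ E x y := fun x y => 𝒮.X.killed_le_exp _ R x y
  have h1 : ∑ y, |𝒮.sg R z y - E z y| ≤ 2 * f ^ α := by
    have e : ∑ y, |𝒮.sg R z y - E z y| = 1 - ∑ y, 𝒮.sg R z y := by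
      rw [← hE1 z, ← Finset.sum_sub_distrib]
      refine Finset.sum_congr rfl fun y _ => ?_
      rw [abs_sub_comm, abs_of_nonneg (sub_nonneg.2 (hle z y))]
    have := le_sum_sg hz hR2
    linarith
  have hTV : ∀ x, ∑ y, |E z y - E x y| ≤ 2 * d + if x ∈ 𝒮.B α R f then 0 else 2 := fun x => by
    split_ifs with hx
    · have := h.fastThermalization z hz x hx
      simp only [MarkovChain.tvDist, MarkovChain.real_path] at this
      simp only [hE]
      linarith
    · have : ∑ y, |E z y - E x y| ≤ ∑ y, (E z y + E x y) := Finset.sum_le_sum fun y _ => by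
        refine (abs_sub _ _).trans ?_
        rw [abs_of_nonneg (hE0 z y), abs_of_nonneg (hE0 x y)]
      rw [Finset.sum_add_distrib, hE1, hE1] at this
      linarith [h.d_mem.1]
  -- The unkilled law from `piA` is the intermediate point: thermalization compares it with the law
  -- from `z`, slow escape with `piA`.
  set a : 𝒮.S → ℝ := fun y => ∑ x, 𝒮.piA x * E x y with ha
  have h2 : ∑ y, |E z y - a y| ≤ 2 * d + 2 * f ^ (1 - α) := by
    calc ∑ y, |E z y - a y| ≤ ∑ y, ∑ x, 𝒮.piA x * |E z y - E x y| := by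
          refine Finset.sum_le_sum fun y _ => ?_
          have e : E z y - a y = ∑ x, 𝒮.piA x * (E z y - E x y) := by
            simp only [mul_sub, Finset.sum_sub_distrib, ← Finset.sum_mul, hp.2, one_mul, ha]
          rw [e]
          refine (Finset.abs_sum_le_sum_abs _ _).trans_eq (Finset.sum_congr rfl fun x _ => ?_)
          rw [abs_mul, abs_of_nonneg (hp.1 x)]
      _ = ∑ x, 𝒮.piA x * ∑ y, |E z y - E x y| := by
          rw [Finset.sum_comm]
          simp only [Finset.mul_sum]
      _ ≤ ∑ x, 𝒮.piA x * (2 * d + if x ∈ 𝒮.B α R f then 0 else 2) :=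
          Finset.sum_le_sum fun x _ => mul_le_mul_of_nonneg_left (hTV x) (hp.1 x)
      _ = 2 * d + 2 * ∑ x, (if x ∈ 𝒮.B α R f then 0 else 𝒮.piA x) := by
          simp only [mul_add, Finset.sum_add_distrib, ← Finset.sum_mul, hp.2, one_mul,
            Finset.mul_sum]
          congr 1
          refine Finset.sum_congr rfl fun x _ => ?_
          split_ifs <;> ring
      _ ≤ 2 * d + 2 * f ^ (1 - α) := by linarith [sum_piA_compl_le h hB]
  have h3 : ∑ y, |a y - 𝒮.piA y| ≤ 2 * f := by
    -- The killed flow from `piA` lies below both `a` and `piA` and has mass at least `1 - f`.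
    set c : 𝒮.S → ℝ := fun y => ∑ x, 𝒮.piA x * 𝒮.sg R x y with hc
    have hc1 : 1 - f ≤ ∑ y, c y := by
      have := le_sum_piA_mul_sum_sg h hB hR2
      simp only [Finset.mul_sum] at this
      rwa [Finset.sum_comm] at this
    have ha1 : ∑ y, a y = 1 := by
      simp only [ha]
      rw [Finset.sum_comm]
      simp only [← Finset.mul_sum, hE1, mul_one, hp.2]
    calc ∑ y, |a y - 𝒮.piA y| ≤ ∑ y, ((a y - c y) + (𝒮.piA y - c y)) :=
          Finset.sum_le_sum fun y _ => by
            have h4 : c y ≤ 𝒮.piA y := 𝒮.sum_piA_mul_sg_le hA R y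
            have h5 : c y ≤ a y := 𝒮.sum_piA_mul_sg_le_exp hA R y
            rw [abs_le]
            constructor <;> linarith
      _ ≤ 2 * f := by
          rw [Finset.sum_add_distrib, Finset.sum_sub_distrib, Finset.sum_sub_distrib, ha1, hp.2]
          linarith
  calc ∑ y, |𝒮.sg R z y - 𝒮.piA y|
      ≤ ∑ y, (|𝒮.sg R z y - E z y| + |E z y - a y| + |a y - 𝒮.piA y|) :=
        Finset.sum_le_sum fun y _ => by
          have := abs_sub_le (𝒮.sg R z y) (E z y) (𝒮.piA y)
          have := abs_sub_le (E z y) (a y) (𝒮.piA y)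
          linarith
    _ ≤ _ := by
        rw [Finset.sum_add_distrib, Finset.sum_add_distrib]
        linarith

/-- After time `R` the killed semigroup does not expand ℓ¹ and moves `piA` by at most `f`. The
window `[R, 2R]` is what remains after a visit to the basin before `R`. -/
lemma sum_abs_sg_sub_le {z : 𝒮.S} (hz : z ∈ 𝒮.B α R f) {t : ℝ≥0} (htR : R ≤ t) (ht : t ≤ 2 * R) :
    ∑ y, |𝒮.sg t z y - 𝒮.piA y| ≤ 2 * f ^ α + 2 * d + 2 * f ^ (1 - α) + 3 * f := by
  have hA := A_nonempty hB
  have hp := 𝒮.piA_mem hA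
  obtain ⟨s, rfl⟩ := exists_add_of_le htR
  have hs : s ≤ 2 * R := le_add_self.trans ht
  set c : 𝒮.S → ℝ := fun y => ∑ x, 𝒮.piA x * 𝒮.sg s x y with hc
  have hc1 : 1 - f ≤ ∑ y, c y := by
    have := le_sum_piA_mul_sum_sg h hB hs
    simp only [Finset.mul_sum] at this
    rwa [Finset.sum_comm] at this
  have h1 : ∑ y, |c y - 𝒮.piA y| ≤ f := by
    have e : ∑ y, |c y - 𝒮.piA y| = ∑ y, 𝒮.piA y - ∑ y, c y := by
      rw [← Finset.sum_sub_distrib]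
      refine Finset.sum_congr rfl fun y _ => ?_
      rw [abs_sub_comm, abs_of_nonneg (sub_nonneg.2 (𝒮.sum_piA_mul_sg_le hA s y))]
    rw [e, hp.2]
    linarith
  have h2 : ∑ y, |𝒮.sg (R + s) z y - c y| ≤ ∑ x, |𝒮.sg R z x - 𝒮.piA x| := by
    calc ∑ y, |𝒮.sg (R + s) z y - c y|
        ≤ ∑ y, ∑ x, |𝒮.sg R z x - 𝒮.piA x| * 𝒮.sg s x y := by
          refine Finset.sum_le_sum fun y _ => ?_
          rw [𝒮.sg_add, Matrix.mul_apply, hc, ← Finset.sum_sub_distrib]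
          refine (Finset.abs_sum_le_sum_abs _ _).trans_eq (Finset.sum_congr rfl fun x _ => ?_)
          rw [← sub_mul, abs_mul, abs_of_nonneg (𝒮.sg_nonneg s x y)]
      _ = ∑ x, |𝒮.sg R z x - 𝒮.piA x| * ∑ y, 𝒮.sg s x y := by
          rw [Finset.sum_comm]
          simp only [Finset.mul_sum]
      _ ≤ ∑ x, |𝒮.sg R z x - 𝒮.piA x| := Finset.sum_le_sum fun x _ =>
          mul_le_of_le_one_right (abs_nonneg _) (𝒮.sum_sg_le_one s x)
  have h3 := sum_abs_sg_R_sub_le h hB hz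
  calc ∑ y, |𝒮.sg (R + s) z y - 𝒮.piA y|
      ≤ ∑ y, (|𝒮.sg (R + s) z y - c y| + |c y - 𝒮.piA y|) :=
        Finset.sum_le_sum fun y _ => abs_sub_le _ _ _
    _ ≤ _ := by
        rw [Finset.sum_add_distrib]
        linarith

/-- First-visit decomposition at `B ∪ G`: relaxation after a visit to the basin, nothing left after
a visit to `G`, and an error `2r` if neither is visited by time `R`. -/
lemma sum_abs_sg_two_mul_sub_le (x : 𝒮.S) :
    ∑ y, |𝒮.sg (2 * R) x y - (∑ z, 𝒮.sg (2 * R) x z) * 𝒮.piA y| ≤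
      2 * (2 * f ^ α + 2 * d + 2 * f ^ (1 - α) + 3 * f) + 2 * r := by
  have hp := 𝒮.piA_mem (A_nonempty hB)
  set θ := 2 * f ^ α + 2 * d + 2 * f ^ (1 - α) + 3 * f with hθ
  obtain ⟨z₀, hz₀⟩ := hB
  have hθ0 : 0 ≤ θ := (Finset.sum_nonneg fun y _ => abs_nonneg _).trans
    (sum_abs_sg_sub_le h ⟨z₀, hz₀⟩ hz₀ le_rfl (le_mul_of_one_le_left R.2 one_le_two))
  -- The ℓ¹ norm is dualized by a sign function; centring it under `piA` turns the rank one
  -- subtraction into a plain application of the semigroup, to a function bounded by `2`.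
  set φ : 𝒮.S → ℝ := fun y =>
    SignType.sign (𝒮.sg (2 * R) x y - (∑ z, 𝒮.sg (2 * R) x z) * 𝒮.piA y) with hφ
  have hφ1 : ∀ y, |φ y| ≤ 1 := fun y => by
    simp only [hφ]
    rcases SignType.sign (𝒮.sg (2 * R) x y - (∑ z, 𝒮.sg (2 * R) x z) * 𝒮.piA y) with _ | _ | _ <;>
      simp
  set b := ∑ y, 𝒮.piA y * φ y with hb
  have hb1 : |b| ≤ 1 := by
    rw [← hp.2]
    refine (Finset.abs_sum_le_sum_abs _ _).trans (Finset.sum_le_sum fun y _ => ?_)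
    rw [abs_mul, abs_of_nonneg (hp.1 y)]
    exact mul_le_of_le_one_right (hp.1 y) (hφ1 y)
  set ψ : 𝒮.S → ℝ := fun y => φ y - b with hψ
  have hmul : ∀ t z, (killed 𝒮.G 𝒮.Q ((t : ℝ≥0) : ℝ)).mulVec ψ z =
      ∑ y, 𝒮.sg t z y * φ y - (∑ y, 𝒮.sg t z y) * b := fun t z => by
    rw [Matrix.mulVec, dotProduct, Finset.sum_mul, ← Finset.sum_sub_distrib]
    exact Finset.sum_congr rfl fun y _ => mul_sub _ _ _
  have hgoal : ∑ y, |𝒮.sg (2 * R) x y - (∑ z, 𝒮.sg (2 * R) x z) * 𝒮.piA y| =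
      (killed 𝒮.G 𝒮.Q ((2 * R : ℝ≥0) : ℝ)).mulVec ψ x := by
    rw [hmul, hb, Finset.mul_sum, ← Finset.sum_sub_distrib]
    refine Finset.sum_congr rfl fun y _ => ?_
    rw [← mul_assoc, ← sub_mul, hφ, self_mul_sign]
  have hnear : ∀ z ∈ 𝒮.B α R f, ∀ t, R ≤ t → t ≤ 2 * R →
      |(killed 𝒮.G 𝒮.Q ((t : ℝ≥0) : ℝ)).mulVec ψ z| ≤ 2 * θ := fun z hz t ht ht' => by
    have h1 := sum_abs_sg_sub_le h ⟨z₀, hz₀⟩ hz ht ht'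
    have e : (killed 𝒮.G 𝒮.Q ((t : ℝ≥0) : ℝ)).mulVec ψ z =
        ∑ y, (𝒮.sg t z y - 𝒮.piA y) * ψ y := by
      have e0 : ∑ y, 𝒮.piA y * ψ y = 0 := by
        simp only [hψ, mul_sub, Finset.sum_sub_distrib, ← Finset.sum_mul, hp.2, one_mul]
        rw [← hb, sub_self]
      simp only [sub_mul, Finset.sum_sub_distrib, e0, sub_zero]
      rfl
    rw [e]
    calc |∑ y, (𝒮.sg t z y - 𝒮.piA y) * ψ y| ≤ ∑ y, 2 * |𝒮.sg t z y - 𝒮.piA y| := by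
          refine (Finset.abs_sum_le_sum_abs _ _).trans (Finset.sum_le_sum fun y _ => ?_)
          rw [abs_mul, mul_comm]
          refine mul_le_mul_of_nonneg_right ?_ (abs_nonneg _)
          exact (abs_sub _ _).trans (by linarith [hφ1 y])
      _ ≤ 2 * θ := by
          rw [← Finset.mul_sum]
          linarith
  have hzero : ∀ z ∈ 𝒮.G, ∀ t : ℝ≥0, (killed 𝒮.G 𝒮.Q (t : ℝ)).mulVec ψ z = 0 := fun z hz t => by
    rw [Matrix.mulVec, dotProduct]
    exact Finset.sum_eq_zero fun y _ => by rw [killed_apply_of_mem_left hz, zero_mul]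
  rw [hgoal]
  refine (le_abs_self _).trans ?_
  by_cases hx : x ∈ 𝒮.B α R f ∪ 𝒮.G
  · rcases hx with hx | hx
    · have := hnear x hx (2 * R) (le_mul_of_one_le_left R.2 one_le_two) le_rfl
      linarith [h.r_mem.1]
    · rw [hzero x hx, abs_zero]
      linarith [h.r_mem.1]
  · have h1 := abs_killed_mulVec_le 𝒮.X 𝒮.isRateMatrix (Set.subset_union_right) R ψ
      (a := 2 * θ) (b := 2) (by linarith) ?_ ?_ hx
    · have h2 := h.fastRecurrence x
      rw [MarkovChain.real_lt_hit] at h2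
      linarith
    · rintro z (hz | hz) t ht ht'
      · exact hnear z hz t ht ht'
      · rw [hzero z hz, abs_zero]
        linarith
    · intro z
      have h0 : (killed 𝒮.G 𝒮.Q (R : ℝ)).mulVec ψ z = ∑ y, 𝒮.sg R z y * ψ y := rfl
      rw [h0]
      calc |∑ y, 𝒮.sg R z y * ψ y| ≤ ∑ y, 𝒮.sg R z y * 2 := by
            refine (Finset.abs_sum_le_sum_abs _ _).trans (Finset.sum_le_sum fun y _ => ?_)
            rw [abs_mul, abs_of_nonneg (𝒮.sg_nonneg R z y)]
            refine mul_le_mul_of_nonneg_left ?_ (𝒮.sg_nonneg R z y)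
            exact (abs_sub _ _).trans (by linarith [hφ1 y])
        _ ≤ 2 := by
            rw [← Finset.sum_mul]
            linarith [𝒮.sum_sg_le_one R z]

omit hB in
lemma cbar_nonneg : 0 ≤ cbar α f r := by
  have h1 : 0 ≤ r + 2 * f ^ α := by
    have := Real.rpow_nonneg h.f_mem.1.le α
    linarith [h.r_mem.1]
  have h2 : √(1 / 4 - (r + 2 * f ^ α)) ≤ 1 / 2 := by
    rw [Real.sqrt_le_left (by norm_num)]
    linarith
  rw [cbar]
  linarith

/-- The factor `4` is dictated by `4 f^(1-α)` in the rank one error, since `eps2` contains that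
power once; all other terms have slack. The bound `1/48` then gives `θ ≤ 1/12`. -/
lemma nearRankOne (hε : r + eps2 α d f r ≤ 1 / 48) :
    NearRankOne 𝒮.sg (2 * R) 𝒮.piA (4 * (r + eps2 α d f r)) where
  add := 𝒮.sg_add
  nonneg := 𝒮.sg_nonneg
  sum_le_one := 𝒮.sum_sg_le_one
  T_pos := mul_pos two_pos (zero_lt_one.trans h.one_lt_R)
  p_mem := 𝒮.piA_mem (A_nonempty hB)
  θ_le := by linarith
  close x := by
    refine (sum_abs_sg_two_mul_sub_le h hB x).trans ?_
    have h1 := cbar_nonneg h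
    have h2 := Real.rpow_nonneg h.f_mem.1.le α
    have h3 := Real.rpow_nonneg h.f_mem.1.le (1 - α)
    rw [eps2]
    linarith [h.r_mem.1, h.d_mem.1, h.f_mem.1]
  survive := by
    refine le_trans ?_ (le_sum_piA_mul_sum_sg h hB le_rfl)
    have h1 := cbar_nonneg h
    have h2 := Real.rpow_nonneg h.f_mem.1.le α
    have h3 := Real.rpow_nonneg h.f_mem.1.le (1 - α)
    rw [eps2]
    linarith [h.r_mem.1, h.d_mem.1, h.f_mem.1]

omit hB in
lemma le_alive_of_mem_B {x : 𝒮.S} (hx : x ∈ 𝒮.B α R f) :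
    1 - 4 * (r + eps2 α d f r) ≤ NearRankOne.alive 𝒮.sg (2 * R) x := by
  refine le_trans ?_ (le_sum_sg hx le_rfl)
  have h1 := cbar_nonneg h
  have h2 := Real.rpow_nonneg h.f_mem.1.le α
  have h3 := Real.rpow_nonneg h.f_mem.1.le (1 - α)
  rw [eps2]
  linarith [h.r_mem.1, h.d_mem.1, h.f_mem.1]

end Hyp

end System

end Metastable

namespace Metastable

/-! ### Mean hitting times from exponential tail bounds. -/

namespace MarkovChain

universe u v

variable {S : Type u} [Fintype S] [DecidableEq S] {Q : Matrix S S ℝ} (X : MarkovChain.{u, v} Q)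

lemma measurable_hit (K : Set S) : Measurable (X.hit K) := by
  refine measurable_of_Ioi fun a => ?_
  induction a with
  | top => simp [Set.preimage]
  | coe a => exact X.measurableSet_lt_hit K a

lemma law_univ {ν : S → ℝ} (hν : ν ∈ stdSimplex ℝ S) : (X.law ν).real Set.univ = 1 := by
  simp [law_real _ _ hν.1, hν.2]

lemma meanHit_eq (K : Set S) (ν : S → ℝ) (hfin : ∀ᵐ ω ∂(X.law ν), X.hit K ω ≠ ∞) :
    X.meanHit K ν =
      ∫⁻ t in Set.Ioi (0 : ℝ), X.law ν {ω | (t.toNNReal : ℝ≥0∞) < X.hit K ω} := by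
  have h1 : X.meanHit K ν = ∫⁻ ω, ENNReal.ofReal (X.hit K ω).toReal ∂(X.law ν) := by
    refine lintegral_congr_ae ?_
    filter_upwards [hfin] with ω hω
    rw [ENNReal.ofReal_toReal hω]
  rw [h1, lintegral_eq_lintegral_meas_lt _ (Eventually.of_forall fun ω => ENNReal.toReal_nonneg)
    (X.measurable_hit K).ennreal_toReal.aemeasurable]
  refine setLIntegral_congr_fun measurableSet_Ioi fun t ht => measure_congr ?_
  filter_upwards [hfin] with ω hω
  refine propext ?_
  change t < (X.hit K ω).toReal ↔ ENNReal.ofReal t < X.hit K ω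
  rw [ENNReal.ofReal_lt_iff_lt_toReal (le_of_lt ht) hω]

lemma lintegral_exp_tail {a l : ℝ} (ha : 0 ≤ a) (hl : 0 < l) :
    ∫⁻ t in Set.Ioi (0 : ℝ), ENNReal.ofReal (a * Real.exp (-(l * t))) = ENNReal.ofReal (a / l) := by
  have hint : IntegrableOn (fun t : ℝ => a * Real.exp (-(l * t))) (Set.Ioi 0) := by
    have := (exp_neg_integrableOn_Ioi 0 hl).const_mul a
    simp only [neg_mul] at this
    exact this
  rw [← ofReal_integral_eq_lintegral_ofReal hint
    (Eventually.of_forall fun t => mul_nonneg ha (Real.exp_pos _).le)]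
  congr 1
  rw [integral_const_mul]
  have := integral_exp_mul_Ioi (neg_lt_zero.2 hl) 0
  simp only [neg_mul] at this
  rw [this]
  simp
  ring

lemma hit_ne_top {K : Set S} {ν : S → ℝ} {b l : ℝ} (hl : 0 < l)
    (hb : ∀ t : ℝ≥0, (X.law ν).real {ω | (t : ℝ≥0∞) < X.hit K ω} ≤ b * Real.exp (-(l * t))) :
    ∀ᵐ ω ∂(X.law ν), X.hit K ω ≠ ∞ := by
  rw [ae_iff, ← measureReal_eq_zero_iff]
  refine le_antisymm ?_ measureReal_nonneg
  have hlim : Tendsto (fun n : ℕ => b * Real.exp (-(l * (n : ℝ)))) atTop (𝓝 (b * 0)) :=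
    (Real.tendsto_exp_neg_atTop_nhds_zero.comp
      (tendsto_natCast_atTop_atTop.const_mul_atTop hl)).const_mul b
  rw [mul_zero] at hlim
  refine ge_of_tendsto' hlim fun n => ?_
  have := hb n
  refine le_trans (measureReal_mono fun ω hω => ?_) this
  have hω' : X.hit K ω = ∞ := not_not.1 hω
  change ((n : ℝ≥0) : ℝ≥0∞) < X.hit K ω
  rw [hω']
  exact ENNReal.coe_lt_top

lemma meanHit_le {K : Set S} {ν : S → ℝ} {b l : ℝ} (hb0 : 0 ≤ b) (hl : 0 < l)
    (hb : ∀ t : ℝ≥0, (X.law ν).real {ω | (t : ℝ≥0∞) < X.hit K ω} ≤ b * Real.exp (-(l * t))) :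
    X.meanHit K ν ≤ ENNReal.ofReal (b / l) := by
  rw [X.meanHit_eq K ν (X.hit_ne_top hl hb), ← lintegral_exp_tail hb0 hl]
  refine setLIntegral_mono' measurableSet_Ioi fun t ht => ?_
  have := hb t.toNNReal
  rw [Real.coe_toNNReal _ (le_of_lt ht)] at this
  rw [← ofReal_measureReal]
  exact ENNReal.ofReal_le_ofReal this

lemma le_meanHit {K : Set S} {ν : S → ℝ} {a b l : ℝ} (ha0 : 0 ≤ a) (hl : 0 < l)
    (ha : ∀ t : ℝ≥0, a * Real.exp (-(l * t)) ≤ (X.law ν).real {ω | (t : ℝ≥0∞) < X.hit K ω})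
    (hb : ∀ t : ℝ≥0, (X.law ν).real {ω | (t : ℝ≥0∞) < X.hit K ω} ≤ b * Real.exp (-(l * t))) :
    ENNReal.ofReal (a / l) ≤ X.meanHit K ν := by
  rw [X.meanHit_eq K ν (X.hit_ne_top hl hb), ← lintegral_exp_tail ha0 hl]
  refine setLIntegral_mono' measurableSet_Ioi fun t ht => ?_
  have := ha t.toNNReal
  rw [Real.coe_toNNReal _ (le_of_lt ht)] at this
  rw [← ofReal_measureReal (μ := X.law ν)]
  exact ENNReal.ofReal_le_ofReal this

lemma abs_real_le_hit_sub_le {K : Set S} {ν : S → ℝ} (hν : ν ∈ stdSimplex ℝ S) {ε l : ℝ}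
    (hl : 0 < l) (hε : 0 ≤ ε)
    (h : ∀ t : ℝ≥0, |(X.law ν).real {ω | (t : ℝ≥0∞) < X.hit K ω} - Real.exp (-(l * t))| ≤
      ε * Real.exp (-(l * t))) (s : ℝ≥0) :
    |(X.law ν).real {ω | (s : ℝ≥0∞) ≤ X.hit K ω} - Real.exp (-(l * s))| ≤
      ε * Real.exp (-(l * s)) := by
  have hlow := (abs_le.1 (h s)).1
  have hmono : (X.law ν).real {ω | (s : ℝ≥0∞) < X.hit K ω} ≤
      (X.law ν).real {ω | (s : ℝ≥0∞) ≤ X.hit K ω} :=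
    measureReal_mono fun ω (hω : (s : ℝ≥0∞) < X.hit K ω) => hω.le
  have hup : (X.law ν).real {ω | (s : ℝ≥0∞) ≤ X.hit K ω} ≤ (1 + ε) * Real.exp (-(l * s)) := by
    have hc : Continuous fun t : ℝ => (1 + ε) * Real.exp (-(l * t)) := by fun_prop
    have hlim : Tendsto (fun t : ℝ => (1 + ε) * Real.exp (-(l * t))) (𝓝[<] (s : ℝ))
        (𝓝 ((1 + ε) * Real.exp (-(l * s)))) := (hc.tendsto _).mono_left nhdsWithin_le_nhds
    refine ge_of_tendsto hlim ?_
    filter_upwards [self_mem_nhdsWithin] with t ht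
    rcases le_or_gt 0 t with h0 | h0
    · lift t to ℝ≥0 using h0
      have h1 := (abs_le.1 (h t)).2
      have h2 : (X.law ν).real {ω | (s : ℝ≥0∞) ≤ X.hit K ω} ≤
          (X.law ν).real {ω | (t : ℝ≥0∞) < X.hit K ω} := measureReal_mono fun ω hω => by
        have : (t : ℝ≥0∞) < s := by exact_mod_cast ht
        exact this.trans_le hω
      linarith
    -- Negative `t` matter when `s = 0`, where they fill the left neighbourhood; the exponential is
    -- then at least `1`.
    · have h1 : (X.law ν).real {ω | (s : ℝ≥0∞) ≤ X.hit K ω} ≤ 1 := by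
        rw [← X.law_univ hν]
        exact measureReal_mono (Set.subset_univ _)
      have h2 : 1 ≤ Real.exp (-(l * t)) := Real.one_le_exp (by nlinarith)
      nlinarith
  rw [abs_le]
  constructor <;> linarith

end MarkovChain

/-! ### The exponential law from the quasistationary measure and from the basin. -/

namespace System

universe u v w

variable {𝒮 : System.{u, v, w}}

lemma law_real_lt_hit {ν : 𝒮.S → ℝ} (hν : ∀ x, 0 ≤ ν x) (t : ℝ≥0) :
    (𝒮.X.law ν).real {ω | (t : ℝ≥0∞) < 𝒮.X.hit 𝒮.G ω} =
      ∑ x, ν x * NearRankOne.alive 𝒮.sg t x := by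
  simp only [MarkovChain.law_real _ _ hν, MarkovChain.real_lt_hit]
  rfl

section QuasiStationary

variable {T : ℝ≥0} {θ : ℝ} (h : NearRankOne 𝒮.sg T 𝒮.piA θ)
include h

lemma condLaw_eq (t : ℝ≥0) (y : 𝒮.S) :
    𝒮.X.condLaw 𝒮.G 𝒮.piA t y = NearRankOne.condFlow 𝒮.sg 𝒮.piA t y := by
  rw [MarkovChain.condLaw, law_real_lt_hit h.p_mem.1, MarkovChain.law_real _ _ h.p_mem.1]
  simp only [MarkovChain.real_path_lt_hit]
  rfl

/-- `limUnder` is meaningful only when a limit exists; the contraction provides it. -/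
lemma tendsto_condFlow (y : 𝒮.S) :
    Tendsto (fun t => NearRankOne.condFlow 𝒮.sg 𝒮.piA t y) atTop (𝓝 (𝒮.quasiStationary y)) := by
  obtain ⟨m, hm⟩ := h.exists_tendsto_condFlow
  have : 𝒮.quasiStationary y = m y := by
    rw [quasiStationary]
    simp only [condLaw_eq h]
    exact (hm y).limUnder_eq
  rw [this]
  exact hm y

lemma quasiStationary_mem : 𝒮.quasiStationary ∈ stdSimplex ℝ 𝒮.S := h.limit_mem (tendsto_condFlow h)

lemma quasiStationary_of_mem {x : 𝒮.S} (hx : x ∈ 𝒮.G) : 𝒮.quasiStationary x = 0 := by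
  refine tendsto_nhds_unique (tendsto_condFlow h x) (tendsto_const_nhds.congr fun t => ?_)
  rw [NearRankOne.condFlow, NearRankOne.flow,
    Finset.sum_eq_zero fun z _ => by rw [𝒮.sg_right hx, mul_zero], zero_div]

lemma quasiStationary_vecMul_survival :
    Matrix.vecMul 𝒮.quasiStationary (survival 𝒮.G) = 𝒮.quasiStationary := by
  ext y
  rw [survival, Matrix.vecMul_diagonal]
  by_cases hy : y ∈ 𝒮.G
  · rw [quasiStationary_of_mem h hy, zero_mul]
  · simp [hy]

/-- The quasistationary law is a left eigenvector of the rates of the killed chain. -/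
lemma exists_eigenvalue :
    ∃ c : ℝ, Matrix.vecMul 𝒮.quasiStationary (killedRate 𝒮.G 𝒮.Q) = c • 𝒮.quasiStationary := by
  set m := 𝒮.quasiStationary with hm
  have hD : ∀ y, HasDerivAt (fun t => Matrix.vecMul m (killed 𝒮.G 𝒮.Q t) y)
      (Matrix.vecMul m (killedRate 𝒮.G 𝒮.Q) y) 0 := fun y => by
    have h1 := hasDerivAt_vecMul_apply (hasDerivAt_killed 𝒮.G 𝒮.Q 0) m y
    rwa [killed_zero, survival_mul_killedRate] at h1
  set c := ∑ y, Matrix.vecMul m (killedRate 𝒮.G 𝒮.Q) y with hc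
  have hsum : HasDerivAt (fun t => ∑ y, Matrix.vecMul m (killed 𝒮.G 𝒮.Q t) y) c 0 :=
    HasDerivAt.fun_sum fun y _ => hD y
  refine ⟨c, funext fun y => ?_⟩
  have h1 : HasDerivAt (fun t => (∑ z, Matrix.vecMul m (killed 𝒮.G 𝒮.Q t) z) * m y) (c * m y) 0 :=
    hsum.mul_const _
  have heq : ∀ t ∈ Set.Ici (0 : ℝ), Matrix.vecMul m (killed 𝒮.G 𝒮.Q t) y =
      (∑ z, Matrix.vecMul m (killed 𝒮.G 𝒮.Q t) z) * m y := fun t ht => by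
    lift t to ℝ≥0 using ht
    have h2 := h.limit_mul (tendsto_condFlow h) t y
    have h3 : ∑ z, Matrix.vecMul m (killed 𝒮.G 𝒮.Q (t : ℝ)) z =
        ∑ x, m x * NearRankOne.alive 𝒮.sg t x := by
      simp only [Matrix.vecMul, dotProduct, NearRankOne.alive, Finset.mul_sum]
      rw [Finset.sum_comm]
      rfl
    rw [h3]
    exact h2
  -- The identity `heq` is known for `t ≥ 0` only, so derivatives at `0` are compared within `[0,
  -- ∞)`.
  have h2 := (hD y).hasDerivWithinAt (s := Set.Ici 0)
  have h3 := (h1.hasDerivWithinAt (s := Set.Ici 0)).congr heq (heq 0 Set.self_mem_Ici)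
  exact (uniqueDiffOn_Ici (0 : ℝ) 0 Set.self_mem_Ici).eq_deriv _ h2 h3

/-- Otherwise `m Q` vanishes off `G`, is nonnegative on `G` and has total zero, so `m` is invariant
for `Q`. Irreducibility makes it positive everywhere, although it vanishes on the nonempty `G`. -/
lemma not_vecMul_killedRate_eq_zero :
    Matrix.vecMul 𝒮.quasiStationary (killedRate 𝒮.G 𝒮.Q) ≠ 0 := by
  intro h0
  set m := 𝒮.quasiStationary with hm
  have hmem : m ∈ stdSimplex ℝ 𝒮.S := quasiStationary_mem h
  have hA : ∀ y ∉ 𝒮.G, ∑ x, m x * 𝒮.Q x y = 0 := fun y hy => by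
    refine Eq.trans ?_ (congrFun h0 y)
    rw [Matrix.vecMul, dotProduct]
    refine Finset.sum_congr rfl fun x _ => ?_
    rw [killedRate_apply]
    by_cases hx : x ∈ 𝒮.G
    · rw [hm, quasiStationary_of_mem h hx, zero_mul, zero_mul]
    · simp [hx, hy]
  have hpos : ∀ y ∈ Finset.univ, 0 ≤ ∑ x, m x * 𝒮.Q x y := fun y _ => by
    by_cases hy : y ∈ 𝒮.G
    · refine Finset.sum_nonneg fun x _ => ?_
      by_cases hxy : x = y
      · rw [hxy, hm, quasiStationary_of_mem h hy, zero_mul]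
      · exact mul_nonneg (hmem.1 x) (𝒮.isRateMatrix.nonneg x y hxy)
    · exact (hA y hy).ge
  have htot : ∑ y, ∑ x, m x * 𝒮.Q x y = 0 := by
    rw [Finset.sum_comm]
    simp only [← Finset.mul_sum, 𝒮.isRateMatrix.row_sum, mul_zero, Finset.sum_const_zero]
  have hinv : IsInvariant 𝒮.Q m :=
    ⟨hmem, fun y => (Finset.sum_eq_zero_iff_of_nonneg hpos).1 htot y (Finset.mem_univ y)⟩
  obtain ⟨g, hg⟩ := 𝒮.nonempty_G
  exact (hinv.pos 𝒮.isRateMatrix 𝒮.irreducible g).ne' (quasiStationary_of_mem h hg)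

/-- From the quasistationary law, the hitting time of the target is exponential. -/
lemma exists_rate : ∃ l > 0, ∀ t : ℝ≥0,
    ∑ x, 𝒮.quasiStationary x * NearRankOne.alive 𝒮.sg t x = Real.exp (-(l * t)) := by
  obtain ⟨c, hc⟩ := exists_eigenvalue h
  have hmem := quasiStationary_mem h
  have key : ∀ t : ℝ≥0,
      ∑ x, 𝒮.quasiStationary x * NearRankOne.alive 𝒮.sg t x = Real.exp (c * t) := fun t => by
    have h1 : Matrix.vecMul 𝒮.quasiStationary (killed 𝒮.G 𝒮.Q t) =
        Real.exp (c * t) • 𝒮.quasiStationary := by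
      rw [killed, ← Matrix.vecMul_vecMul, quasiStationary_vecMul_survival h,
        vecMul_exp_of_eigenvector hc]
    calc ∑ x, 𝒮.quasiStationary x * NearRankOne.alive 𝒮.sg t x
        = ∑ y, Matrix.vecMul 𝒮.quasiStationary (killed 𝒮.G 𝒮.Q t) y := by
          simp only [Matrix.vecMul, dotProduct, NearRankOne.alive, Finset.mul_sum]
          rw [Finset.sum_comm]
          rfl
      _ = Real.exp (c * t) := by
          simp only [h1, Pi.smul_apply, smul_eq_mul, ← Finset.mul_sum, hmem.2, mul_one]
  have hc0 : c ≠ 0 := fun h0 => not_vecMul_killedRate_eq_zero h (by rw [hc, h0, zero_smul])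
  have hc1 : c ≤ 0 := by
    have h1 : Real.exp (c * (1 : ℝ≥0)) ≤ 1 := by
      rw [← key 1, ← hmem.2]
      exact Finset.sum_le_sum fun x _ =>
        mul_le_of_le_one_right (hmem.1 x) (h.alive_le_one 1 x)
    simpa using h1
  exact ⟨-c, neg_pos.2 (lt_of_le_of_ne hc1 hc0), fun t => by rw [key, neg_mul, neg_neg]⟩

end QuasiStationary

/-- Starting from the basin, the hitting time of the target is nearly exponential, with the rate
of the quasistationary law. -/
lemma exists_rate_and_tail {α : ℝ} {R : ℝ≥0} {d f r : ℝ} (h : 𝒮.HpG α R d f r)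
    (hε : r + eps2 α d f r ≤ 1 / 48) {μ : 𝒮.S → ℝ} (hμ : 𝒮.IsProbOn (𝒮.B α R f) μ) :
    ∃ l > 0, 𝒮.Tstar = ENNReal.ofReal (1 / l) ∧ ∀ t : ℝ≥0,
      |(𝒮.X.law μ).real {ω | (t : ℝ≥0∞) < 𝒮.X.hit 𝒮.G ω} - Real.exp (-(l * t))| ≤
        48 * (r + eps2 α d f r) * Real.exp (-(l * t)) := by
  obtain ⟨hμ1, hμ2⟩ := hμ
  have hB : (𝒮.B α R f).Nonempty := by
    by_contra hcon
    rw [Set.not_nonempty_iff_eq_empty] at hcon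
    rw [hcon, Set.subset_empty_iff, Function.support_eq_empty_iff] at hμ2
    have := hμ1.2
    simp [hμ2] at this
  have hN := nearRankOne h hB hε
  obtain ⟨l, hl, hrate⟩ := exists_rate hN
  have htail : ∀ t : ℝ≥0, (𝒮.X.law 𝒮.quasiStationary).real {ω | (t : ℝ≥0∞) < 𝒮.X.hit 𝒮.G ω} =
      1 * Real.exp (-(l * t)) := fun t => by
    rw [law_real_lt_hit (quasiStationary_mem hN).1, hrate, one_mul]
  refine ⟨l, hl, le_antisymm ?_ ?_, fun t => ?_⟩
  · exact 𝒮.X.meanHit_le zero_le_one hl fun t => (htail t).le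
  · exact 𝒮.X.le_meanHit zero_le_one hl (fun t => (htail t).ge) fun t => (htail t).le
  · rw [law_real_lt_hit hμ1.1]
    have e : ∑ x, μ x * NearRankOne.alive 𝒮.sg t x - Real.exp (-(l * t)) =
        ∑ x, μ x * (NearRankOne.alive 𝒮.sg t x - Real.exp (-(l * t))) := by
      simp only [mul_sub, Finset.sum_sub_distrib, ← Finset.sum_mul, hμ1.2, one_mul]
    rw [e]
    calc |∑ x, μ x * (NearRankOne.alive 𝒮.sg t x - Real.exp (-(l * t)))|
        ≤ ∑ x, μ x * (48 * (r + eps2 α d f r) * Real.exp (-(l * t))) := by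
          refine (Finset.abs_sum_le_sum_abs _ _).trans (Finset.sum_le_sum fun x _ => ?_)
          rw [abs_mul, abs_of_nonneg (hμ1.1 x)]
          by_cases hx : μ x = 0
          · rw [hx, zero_mul, zero_mul]
          · refine mul_le_mul_of_nonneg_left ?_ (hμ1.1 x)
            -- `48 = 12 * 4`: the relative error `12θ` with `θ = 4 (r + ε₂)`.
            have := hN.abs_alive_sub_limit_le (tendsto_condFlow hN)
              (le_alive_of_mem_B h (hμ2 hx)) t
            rw [hrate] at this
            refine this.trans_eq ?_
            ring
      _ = 48 * (r + eps2 α d f r) * Real.exp (-(l * t)) := by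
          rw [← Finset.sum_mul, hμ1.2, one_mul]

lemma error_nonneg {α : ℝ} {R : ℝ≥0} {d f r : ℝ} (h : 𝒮.HpG α R d f r) :
    0 ≤ r + eps2 α d f r := by
  have h1 := cbar_nonneg h
  have h2 := Real.rpow_nonneg h.f_mem.1.le α
  have h3 := Real.rpow_nonneg h.f_mem.1.le (1 - α)
  rw [eps2]
  linarith [h.r_mem.1, h.d_mem.1, h.f_mem.1]

lemma abs_real_le_hit_div_sub_le {α : ℝ} {R : ℝ≥0} {d f r : ℝ} (h : 𝒮.HpG α R d f r)
    (hε : r + eps2 α d f r ≤ 1 / 48) {μ : 𝒮.S → ℝ} (hμ : 𝒮.IsProbOn (𝒮.B α R f) μ) (t : ℝ≥0) :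
    |(𝒮.X.law μ).real {ω | (t : ℝ≥0∞) ≤ 𝒮.X.hit 𝒮.G ω / 𝒮.Tstar} - Real.exp (-(t : ℝ))| ≤
      48 * (r + eps2 α d f r) * Real.exp (-(t : ℝ)) := by
  obtain ⟨l, hl, hT, htail⟩ := exists_rate_and_tail h hε hμ
  have hε0 : 0 ≤ 48 * (r + eps2 α d f r) := mul_nonneg (by norm_num) (error_nonneg h)
  have key := 𝒮.X.abs_real_le_hit_sub_le hμ.1 hl hε0 htail (t * (1 / l).toNNReal)
  have e1 : l * ((t * (1 / l).toNNReal : ℝ≥0) : ℝ) = t := by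
    rw [NNReal.coe_mul, Real.coe_toNNReal _ (by positivity)]
    field_simp
  have e2 : {ω | (t : ℝ≥0∞) ≤ 𝒮.X.hit 𝒮.G ω / 𝒮.Tstar} =
      {ω | ((t * (1 / l).toNNReal : ℝ≥0) : ℝ≥0∞) ≤ 𝒮.X.hit 𝒮.G ω} := by
    ext ω
    have hpos : ENNReal.ofReal (1 / l) ≠ 0 := by
      rw [Ne, ENNReal.ofReal_eq_zero, not_le]
      positivity
    change (t : ℝ≥0∞) ≤ 𝒮.X.hit 𝒮.G ω / 𝒮.Tstar ↔ _ ≤ 𝒮.X.hit 𝒮.G ω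
    rw [hT, ENNReal.le_div_iff_mul_le (Or.inl hpos) (Or.inl ENNReal.ofReal_ne_top),
      ENNReal.coe_mul]
    rfl
  rw [e1] at key
  rwa [e2]

/-- Integrating the two-sided tail bound puts the mean from `μ` between `(1 - ε) / l` and `(1 + ε) /
l`. The threshold `1/96` keeps `ε ≤ 1/2`, so the lower bound is positive. -/
lemma Tstar_div_meanHit_mem {α : ℝ} {R : ℝ≥0} {d f r : ℝ} (h : 𝒮.HpG α R d f r)
    (hε : r + eps2 α d f r ≤ 1 / 96) {μ : 𝒮.S → ℝ} (hμ : 𝒮.IsProbOn (𝒮.B α R f) μ) :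
    ENNReal.ofReal (1 / (1 + 48 * (r + eps2 α d f r))) ≤ 𝒮.Tstar / 𝒮.X.meanHit 𝒮.G μ ∧
      𝒮.Tstar / 𝒮.X.meanHit 𝒮.G μ ≤ ENNReal.ofReal (1 / (1 - 48 * (r + eps2 α d f r))) := by
  obtain ⟨l, hl, hT, htail⟩ := exists_rate_and_tail h (by linarith) hμ
  have hε0 := error_nonneg h
  set ε := 48 * (r + eps2 α d f r) with hεdef
  have h0 : 0 ≤ ε := by positivity
  have h1 : 0 < 1 - ε := by linarith
  have hup : ∀ t : ℝ≥0, (𝒮.X.law μ).real {ω | (t : ℝ≥0∞) < 𝒮.X.hit 𝒮.G ω} ≤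
      (1 + ε) * Real.exp (-(l * t)) := fun t => by linarith [(abs_le.1 (htail t)).2]
  have hlow : ∀ t : ℝ≥0, (1 - ε) * Real.exp (-(l * t)) ≤
      (𝒮.X.law μ).real {ω | (t : ℝ≥0∞) < 𝒮.X.hit 𝒮.G ω} :=
    fun t => by linarith [(abs_le.1 (htail t)).1]
  have hM1 := 𝒮.X.meanHit_le (by linarith) hl hup
  have hM2 := 𝒮.X.le_meanHit h1.le hl hlow hup
  have hdiv : ∀ a : ℝ, 0 < a →
      ENNReal.ofReal (1 / l) / ENNReal.ofReal (a / l) = ENNReal.ofReal (1 / a) := fun a ha => by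
    rw [← ENNReal.ofReal_div_of_pos (by positivity)]
    congr 1
    field_simp
  rw [hT, ← hdiv _ h1, ← hdiv (1 + ε) (by linarith)]
  exact ⟨ENNReal.div_le_div_left hM1 _, ENNReal.div_le_div_left hM2 _⟩

end System

lemma tendsto_error {α : ℝ} (hα : α ∈ Set.Ioo (0 : ℝ) 1) {d f r : ℕ → ℝ}
    (hd : Tendsto d atTop (𝓝 0)) (hf : Tendsto f atTop (𝓝 0)) (hr : Tendsto r atTop (𝓝 0)) :
    Tendsto (fun n => r n + eps2 α (d n) (f n) (r n)) atTop (𝓝 0) := by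
  have hrpow : ∀ β : ℝ, 0 < β → Tendsto (fun n => f n ^ β) atTop (𝓝 0) := fun β hβ => by
    simpa [Real.zero_rpow hβ.ne'] using hf.rpow_const (p := β) (Or.inr hβ.le)
  have h1 := hrpow α hα.1
  have h2 := hrpow (1 - α) (sub_pos.2 hα.2)
  have hc : Tendsto (fun n => cbar α (f n) (r n)) atTop (𝓝 0) := by
    have h3 : Tendsto (fun n => 1 / 4 - (r n + 2 * f n ^ α)) atTop (𝓝 (1 / 4 - (0 + 2 * 0))) :=
      tendsto_const_nhds.sub (hr.add (h1.const_mul 2))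
    have h4 := (tendsto_const_nhds (x := (1 / 2 : ℝ))).sub h3.sqrt
    have e : (1 / 2 : ℝ) - √(1 / 4 - (0 + 2 * 0)) = 0 := by
      rw [show (1 / 4 - (0 + 2 * 0) : ℝ) = (1 / 2) ^ 2 by norm_num,
        Real.sqrt_sq (by norm_num), sub_self]
    rw [e] at h4
    exact h4
  have h5 := hr.add (((((hc.add (hf.const_mul 2)).add h1).add hd).const_mul 4).add h2)
  simpa [eps2] using h5

end Metastable

end

theorem corollary3p8 :
    (∃ C > (0 : ℝ), ∃ η > (0 : ℝ), ∀ (𝒮 : Metastable.System) (α : ℝ) (R : ℝ≥0) (d f r : ℝ),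
      𝒮.HpG α R d f r → r + 2 * f ^ α < 1 / 4 → r + Metastable.eps2 α d f r ≤ η →
      ∀ μ : 𝒮.S → ℝ, 𝒮.IsProbOn (𝒮.B α R f) μ → ∀ t : ℝ≥0,
        |(𝒮.X.law μ).real {ω | (t : ℝ≥0∞) ≤ 𝒮.X.hit 𝒮.G ω / 𝒮.Tstar} - Real.exp (-(t : ℝ))| ≤
          C * (r + Metastable.eps2 α d f r) * Real.exp (-(t : ℝ))) ∧
    (∀ (𝒮 : ℕ → Metastable.System) (α : ℝ) (R : ℕ → ℝ≥0) (d f r : ℕ → ℝ),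
      (∀ n, (𝒮 n).HpG α (R n) (d n) (f n) (r n)) →
      Tendsto d atTop (𝓝 0) → Tendsto f atTop (𝓝 0) → Tendsto r atTop (𝓝 0) →
      ∀ μ : ∀ n, (𝒮 n).S → ℝ, (∀ n, (𝒮 n).IsProbOn ((𝒮 n).B α (R n) (f n)) (μ n)) →
        Tendsto (fun n => (𝒮 n).Tstar / (𝒮 n).X.meanHit (𝒮 n).G (μ n)) atTop (𝓝 1)) := by
  refine ⟨⟨48, by norm_num, 1 / 48, by norm_num, ?_⟩, ?_⟩
  · intro 𝒮 α R d f r h _ hε μ hμ t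
    exact Metastable.System.abs_real_le_hit_div_sub_le h hε hμ t
  · intro 𝒮 α R d f r h hd hf hr μ hμ
    have hε := Metastable.tendsto_error (h 0).α_mem hd hf hr
    have hsmall := hε.eventually_le_const (show (0 : ℝ) < 1 / 96 by norm_num)
    have hlow : Tendsto (fun n => ENNReal.ofReal
        (1 / (1 + 48 * (r n + Metastable.eps2 α (d n) (f n) (r n))))) atTop (𝓝 1) := by
      have h1 := ((hε.const_mul 48).const_add 1).inv₀ (by norm_num)
      simpa using ENNReal.tendsto_ofReal h1
    have hup : Tendsto (fun n => ENNReal.ofReal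
        (1 / (1 - 48 * (r n + Metastable.eps2 α (d n) (f n) (r n))))) atTop (𝓝 1) := by
      have h1 := ((hε.const_mul 48).const_sub 1).inv₀ (by norm_num)
      simpa using ENNReal.tendsto_ofReal h1
    refine tendsto_of_tendsto_of_tendsto_of_le_of_le' hlow hup ?_ ?_
    · filter_upwards [hsmall] with n hn
      exact (Metastable.System.Tstar_div_meanHit_mem (h n) hn (hμ n)).1
    · filter_upwards [hsmall] with n hn
      exact (Metastable.System.Tstar_div_meanHit_mem (h n) hn (hμ n)).2
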